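/- **Setting.** Let $D$ be a measurable space, $p\ge 0$, $\Theta\subseteq\mathbb R^p$ a Borel set and $\theta_0\in\operatorname{int}\Theta$. For each $\theta\in\Theta$ let $(P^\theta_t)_{t\ge0}$ be a semigroup of Markov transition kernels on $D$ with invariant probability measure $\mu^\theta$. On a probability space $(\Omega,\mathcal F,\mathbb P)$ let $Y^1,Y^2,\dots$ be i.i.d. copies of the stationary Markov process $(Y_t)_{t\ge0}$ with transition semigroup $(P^{\theta_0}_t)$ and initial law $\mu^{\theta_0}$. Fix $\Delta>0$ and an integer $m\ge1$. Let $h:D^2\times\Theta\to\mathbb R^p$ be measurable such that, for all $\theta\in\Theta$ and $x_1\in D$, $h(x_1,\cdot\,;\theta)$ is $P^\theta_\Delta(x_1,\cdot)$-integrable with $\int_D h(x_1,x_2;\theta)\,P^\theta_\Delta(x_1,dx_2)=0$. Put $$G_n(\theta)=\frac1n\sum_{i=1}^n\sum_{j=1}^m h(Y^i_{(j-1)\Delta},Y^i_{j\Delta};\theta),\qquad Q(dx_1,dx_2)=\mu^{\theta_0}(dx_1)\,P^{\theta_0}_\Delta(x_1,dx_2),$$ and write $Q(f)=\int f\,dQ$.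 Assume: 1. $h(\cdot,\cdot\,;\theta)$ is square-integrable with respect to $Q$ for all $\theta\in\Theta$; 2. $\theta\mapsto h(x_1,x_2;\theta)$ is $C^1$ on $\Theta$ for all $(x_1,x_2)\in D^2$; 3. for every compact $M\subseteq\Theta$ there is a $Q$-integrable $\bar h_M:D^2\to\mathbb R$ with $\|\partial_\theta h(x_1,x_2;\theta)\|\le\bar h_M(x_1,x_2)$ for all $\theta\in M$ and $(x_1,x_2)\in D^2$; 4. the $p\times p$ matrix $Q(\partial_\theta h(\theta_0))$ is invertible. (At non-interior points of $\Theta$, $C^1$ and $\partial_\theta$ are understood relative to $\Theta$.) **Definitions.** Let $\mathcal F_n$ be the $\sigma$-field generated by $Y^i_{j\Delta}$ ($1\le i\le n$, $0\le j\le m$), completed by the $\mathbb P$-null sets. Let $\delta\notin\Theta$, $\Theta_\delta=\Theta\cup\{\delta\}$, with distance $1$ between $\delta$ and each point of $\Theta$ and the Euclidean distance on $\Theta$. Let $D_n$ be the set of $\omega$ for which $G_n(\theta)=0$ for some $\theta\in\Theta$. A *$G_n$-estimator* is an $\mathcal F_n$-measurable map $\hat\theta_n:\Omega\to\Theta_\delta$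 with $\hat\theta_n\in\Theta$ and $G_n(\hat\theta_n)=0$ on $D_n$, and $\hat\theta_n=\delta$ off $D_n$. A sequence of estimators is weakly (strongly) consistent if $\hat\theta_n\to\theta_0$ in probability (almost surely). A sequence $(\hat\theta_n)$ of $G_n$-estimators is *eventually unique* if $\mathbb P(\hat\theta_n\ne\hat\theta_n')\to0$ for every weakly consistent sequence $(\hat\theta'_n)$ of $G_n$-estimators. If $\psi:\Theta\to\mathbb R^p$ is a homeomorphism and $\rho\in\Theta$, a *$\rho$-centred* $G_n$-estimator is an $\mathcal F_n$-measurable map $\hat\theta_n^\rho:\Omega\to\Theta_\delta$ which on $D_n$ is a minimizer of $|\psi(\theta)-\psi(\rho)|$ over the roots $\theta\in\Theta$ of $G_n$, and equals $\delta$ off $D_n$. **Theorem.** (A) There is a strongly consistent, eventually unique sequence $(\hat\theta_n)$ of $G_n$-estimators satisfying $$\mathbb P(\hat\theta_n=\delta)\to0,\qquad \sqrt n\,(\hat\theta_n-\theta_0)\ \xrightarrow{\ \mathcal L\ }\ N_p\big(0,\,m^{-1}V(\theta_0)\big),\tag{$*$}$$ where (with any fixed value given to $\hat\theta_n-\theta_0$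 on $\{\hat\theta_n=\delta\}$) $$V(\theta_0)=Q(\partial_\theta h(\theta_0))^{-1}\;Q\big(h(\theta_0)h(\theta_0)^{*}\big)\;\big(Q(\partial_\theta h(\theta_0))^{*}\big)^{-1}.$$ (B) Suppose in addition that for every compact $K\subseteq\Theta$ there are a compact $M\subseteq\Theta$, a finite $F\subseteq M$ and $L<\infty$ such that each point of $K$ is joined to a point of $F$ by a curve in $M$ of length at most $L$. (This is automatic if $\Theta$ is open, in particular if it is homeomorphic to $\mathbb R^p$, or if $\Theta$ is convex.) Suppose also that $Q(h(\theta))\ne0$ for all $\theta\in\Theta\setminus\{\theta_0\}$. Then: - for every sequence $(\hat\theta_n)$ of $G_n$-estimators, every compact neighbourhood $K\subseteq\Theta$ of $\theta_0$ and every $\varepsilon>0$, $\mathbb P(\hat\theta_n\in K,\ |\hat\theta_n-\theta_0|>\varepsilon)\to0$; - if $\Theta$ is compact, every sequence of $G_n$-estimators satisfies $(*)$; - if $\Theta$ is homeomorphic to $\mathbb R^p$ via some $\psi$, then for every $\rho\in\Theta$ every sequence of $\rho$-centred $G_n$-estimators (for $\psi$) satisfies $(*)$. -/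

import Mathlib

open MeasureTheory ProbabilityTheory Filter Set Topology
open scoped NNReal ENNReal

noncomputable section

namespace Longitudinal

/-- A statistical model of stationary Markov processes on the state space `D`, indexed by `Θ`:
for each `θ` a transition semigroup `(P θ t)_{t ≥ 0}` of Markov kernels together with a
stationary (invariant) initial probability distribution `μ θ`. -/
structure StationaryMarkovModel (D : Type*) [MeasurableSpace D] (Θ : Type*) where
  P : Θ → ℝ≥0 → Kernel D D
  μ : Θ → Measure D
  isMarkovKernel : ∀ θ t, IsMarkovKernel (P θ t)
  isProbabilityMeasure : ∀ θ, IsProbabilityMeasure (μ θ)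
  semigroup_zero : ∀ θ, P θ 0 = Kernel.id
  semigroup_add : ∀ θ s t, P θ (s + t) = P θ t ∘ₖ P θ s
  invariant : ∀ θ t, Kernel.Invariant (P θ t) (μ θ)

/-- The process `Y = (Y_t)_{t ≥ 0}` is, under `Pr`, a (time-homogeneous) Markov process with
transition kernels `κ` and initial distribution `ν`; the Markov property is with respect to the
filtration generated by `Y`. -/
structure IsMarkovProcess {Ω D : Type*} [MeasurableSpace Ω] [MeasurableSpace D]
    (Pr : Measure Ω) (Y : ℝ≥0 → Ω → D) (κ : ℝ≥0 → Kernel D D) (ν : Measure D) : Prop where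
  measurable : ∀ t, Measurable (Y t)
  initial : Pr.map (Y 0) = ν
  markov : ∀ (s t : ℝ≥0) (A : Set D), MeasurableSet A →
    Pr[(Y (s + t) ⁻¹' A).indicator (fun _ => (1 : ℝ)) |
        ⨆ u : Set.Iic s, MeasurableSpace.comap (Y u) inferInstance]
      =ᵐ[Pr] fun ω => (κ t (Y s ω)).real A

/-- `Y 0, Y 1, …` are independent copies (on one probability space) of the stationary Markov
process of the model with parameter `θ₀`. -/
structure IsIIDSample {Ω D Θ : Type*} [MeasurableSpace Ω] [MeasurableSpace D]
    (Pr : Measure Ω) (Mod : StationaryMarkovModel D Θ) (θ₀ : Θ) (Y : ℕ → ℝ≥0 → Ω → D) :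
    Prop where
  indep : iIndepFun (fun (i : ℕ) (ω : Ω) (t : ℝ≥0) => Y i t ω) Pr
  markov : ∀ i, IsMarkovProcess Pr (Y i) (Mod.P θ₀) (Mod.μ θ₀)

/-- The `σ`-field generated by the data `Y i (jΔ)`, `i < n`, `0 ≤ j ≤ m`, completed by the
`Pr`-null sets. -/
abbrev obsSigma {Ω D : Type*} [MeasurableSpace Ω] [MeasurableSpace D]
    (Pr : Measure Ω) (Y : ℕ → ℝ≥0 → Ω → D) (Δ : ℝ≥0) (m n : ℕ) : MeasurableSpace Ω :=
  eventuallyMeasurableSpace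
    (⨆ (i : Fin n) (j : Fin (m + 1)), MeasurableSpace.comap (Y i ((j : ℕ) * Δ)) inferInstance)
    (ae Pr)

/-- The estimating function
`G_n(θ) = n⁻¹ ∑_{i=1}^n ∑_{j=1}^m h(Y^i_{(j-1)Δ}, Y^i_{jΔ}; θ)`. -/
def estFun {Ω D : Type*} {p : ℕ} (h : D → D → EuclideanSpace ℝ (Fin p) → EuclideanSpace ℝ (Fin p))
    (Y : ℕ → ℝ≥0 → Ω → D) (Δ : ℝ≥0) (m n : ℕ) (θ : EuclideanSpace ℝ (Fin p)) (ω : Ω) :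
    EuclideanSpace ℝ (Fin p) :=
  (n : ℝ)⁻¹ • ∑ i ∈ Finset.range n, ∑ j ∈ Finset.range m,
    h (Y i ((j : ℝ≥0) * Δ) ω) (Y i (((j + 1 : ℕ) : ℝ≥0) * Δ) ω) θ

section Estimators

variable {Ω : Type*} {p : ℕ} {Θ : Set (EuclideanSpace ℝ (Fin p))}

/-- Measurability of a map into `Θ_δ = Θ ∪ {δ}`, which is modelled by `Option Θ` with
`δ = none`. -/
def IsMeasurableEst (ℱ : MeasurableSpace Ω) (T : Ω → Option Θ) : Prop :=
  ∀ B : Set Θ, MeasurableSet B → MeasurableSet[ℱ] {ω | ∃ θ ∈ B, T ω = some θ}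

/-- The domain of definition of `G`-estimators. -/
def estDomain (Θ : Set (EuclideanSpace ℝ (Fin p)))
    (G : EuclideanSpace ℝ (Fin p) → Ω → EuclideanSpace ℝ (Fin p)) : Set Ω :=
  {ω | ∃ θ ∈ Θ, G θ ω = 0}

/-- `T` is a `G`-estimator. -/
structure IsGEstimator (ℱ : MeasurableSpace Ω)
    (G : EuclideanSpace ℝ (Fin p) → Ω → EuclideanSpace ℝ (Fin p)) (T : Ω → Option Θ) :
    Prop where
  measurable : IsMeasurableEst ℱ T
  root : ∀ ω ∈ estDomain Θ G, ∃ θ : Θ, T ω = some θ ∧ G θ ω = 0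
  outside : ∀ ω ∉ estDomain Θ G, T ω = none

/-- `T` is a `ρ`-centred `G`-estimator, relative to the metric `d(θ, θ') = |ψ θ - ψ θ'|`. -/
structure IsCenteredGEstimator (ℱ : MeasurableSpace Ω)
    (G : EuclideanSpace ℝ (Fin p) → Ω → EuclideanSpace ℝ (Fin p))
    (ψ : Θ ≃ₜ EuclideanSpace ℝ (Fin p)) (ρ : Θ) (T : Ω → Option Θ) : Prop where
  measurable : IsMeasurableEst ℱ T
  argmin : ∀ ω ∈ estDomain Θ G, ∃ θ : Θ, T ω = some θ ∧ G θ ω = 0 ∧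
    ∀ θ' : Θ, G θ' ω = 0 → dist (ψ θ) (ψ ρ) ≤ dist (ψ θ') (ψ ρ)
  outside : ∀ ω ∉ estDomain Θ G, T ω = none

/-- Distance in `Θ_δ` to a point of `Θ`: Euclidean on `Θ`, and equal to `1` from `δ`. -/
def distTo (θ₀ : Θ) : Option Θ → ℝ
  | none => 1
  | some θ => dist θ θ₀

/-- The vector `θ̂ - θ₀`, with the (asymptotically irrelevant) value `0` if `θ̂ = δ`. -/
def deviation (θ₀ : Θ) : Option Θ → EuclideanSpace ℝ (Fin p)
  | none => 0
  | some θ => (θ : EuclideanSpace ℝ (Fin p)) - θ₀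

variable [MeasurableSpace Ω]

def WeaklyConsistent (Pr : Measure Ω) (θ₀ : Θ) (T : ℕ → Ω → Option Θ) : Prop :=
  TendstoInMeasure Pr (fun n ω => distTo θ₀ (T n ω)) atTop (fun _ => (0 : ℝ))

def StronglyConsistent (Pr : Measure Ω) (θ₀ : Θ) (T : ℕ → Ω → Option Θ) : Prop :=
  ∀ᵐ ω ∂Pr, Tendsto (fun n => distTo θ₀ (T n ω)) atTop (𝓝 0)

/-- Any other weakly consistent sequence of `G_n`-estimators coincides with `T` with probability
tending to one. -/
def EventuallyUnique (Pr : Measure Ω) (ℱ : ℕ → MeasurableSpace Ω)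
    (G : ℕ → EuclideanSpace ℝ (Fin p) → Ω → EuclideanSpace ℝ (Fin p)) (θ₀ : Θ)
    (T : ℕ → Ω → Option Θ) : Prop :=
  ∀ T' : ℕ → Ω → Option Θ, (∀ n, IsGEstimator (ℱ n) (G n) (T' n)) →
    WeaklyConsistent Pr θ₀ T' →
    Tendsto (fun n => Pr {ω | T n ω ≠ T' n ω}) atTop (𝓝 0)

/-- `√n (θ̂_n - θ₀)` is defined with probability tending to one and converges in law to
`N_p(0, S)`. -/
def AsymptoticallyNormal (Pr : Measure Ω) [IsProbabilityMeasure Pr] (θ₀ : Θ)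
    (T : ℕ → Ω → Option Θ) (S : Matrix (Fin p) (Fin p) ℝ) : Prop :=
  Tendsto (fun n => Pr {ω | T n ω = none}) atTop (𝓝 0) ∧
  TendstoInDistribution (fun (n : ℕ) ω => √(n : ℝ) • deviation θ₀ (T n ω)) atTop
    (id : EuclideanSpace ℝ (Fin p) → EuclideanSpace ℝ (Fin p)) (fun _ => Pr)
    (multivariateGaussian 0 S)

end Estimators

section Conditions

variable {D : Type*} [MeasurableSpace D] {p : ℕ} {Θ : Set (EuclideanSpace ℝ (Fin p))}

/-- The law `Q(dx₁, dx₂) = μ^{θ₀}(dx₁) P^{θ₀}_Δ(x₁, dx₂)` on `D × D`. -/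
def pairLaw (Mod : StationaryMarkovModel D Θ) (θ₀ : Θ) (Δ : ℝ≥0) : Measure (D × D) :=
  Mod.μ θ₀ ⊗ₘ Mod.P θ₀ Δ

/-- The martingale property `∫ h(x₁, x₂; θ) P^θ_Δ(x₁, dx₂) = 0` for all `θ` and `x₁`. -/
def IsMartingaleEstFun (Mod : StationaryMarkovModel D Θ) (Δ : ℝ≥0)
    (h : D → D → EuclideanSpace ℝ (Fin p) → EuclideanSpace ℝ (Fin p)) : Prop :=
  ∀ (θ : Θ) (x₁ : D), Integrable (fun x₂ => h x₁ x₂ θ) (Mod.P θ Δ x₁) ∧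
    ∫ x₂, h x₁ x₂ θ ∂(Mod.P θ Δ x₁) = 0

/-- The derivative `∂_θ h(x₁, x₂; θ)`, relative to the parameter set `Θ` (the usual derivative at
interior points). -/
def dh (Θ : Set (EuclideanSpace ℝ (Fin p)))
    (h : D → D → EuclideanSpace ℝ (Fin p) → EuclideanSpace ℝ (Fin p)) (x₁ x₂ : D)
    (θ : EuclideanSpace ℝ (Fin p)) : EuclideanSpace ℝ (Fin p) →L[ℝ] EuclideanSpace ℝ (Fin p) :=
  fderivWithin ℝ (fun θ' => h x₁ x₂ θ') Θ θ

/-- The matrix `Q(∂_θ h(θ))`, with `(k, l)` entry `∫ ∂h_k/∂θ_l dQ`. -/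
def meanJacobian (Θ : Set (EuclideanSpace ℝ (Fin p))) (Q : Measure (D × D))
    (h : D → D → EuclideanSpace ℝ (Fin p) → EuclideanSpace ℝ (Fin p))
    (θ : EuclideanSpace ℝ (Fin p)) : Matrix (Fin p) (Fin p) ℝ :=
  Matrix.of fun k l => ∫ z, (dh Θ h z.1 z.2 θ (EuclideanSpace.single l 1)) k ∂Q

/-- The matrix `Q(h(θ) h(θ)^*)`. -/
def meanOuter (Q : Measure (D × D))
    (h : D → D → EuclideanSpace ℝ (Fin p) → EuclideanSpace ℝ (Fin p))
    (θ : EuclideanSpace ℝ (Fin p)) : Matrix (Fin p) (Fin p) ℝ :=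
  Matrix.of fun k l => ∫ z, (h z.1 z.2 θ) k * (h z.1 z.2 θ) l ∂Q

/-- The sandwich matrix `V(θ) = Q(∂_θ h(θ))⁻¹ Q(h(θ) h(θ)^*) (Q(∂_θ h(θ))^*)⁻¹`. -/
def sandwich (Θ : Set (EuclideanSpace ℝ (Fin p))) (Q : Measure (D × D))
    (h : D → D → EuclideanSpace ℝ (Fin p) → EuclideanSpace ℝ (Fin p))
    (θ : EuclideanSpace ℝ (Fin p)) : Matrix (Fin p) (Fin p) ℝ :=
  (meanJacobian Θ Q h θ)⁻¹ * meanOuter Q h θ * ((meanJacobian Θ Q h θ).transpose)⁻¹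

/-- The regularity condition on `h`. -/
structure RegularityCondition (Θ : Set (EuclideanSpace ℝ (Fin p))) (Q : Measure (D × D))
    (h : D → D → EuclideanSpace ℝ (Fin p) → EuclideanSpace ℝ (Fin p))
    (θ₀ : EuclideanSpace ℝ (Fin p)) : Prop where
  sq_integrable : ∀ θ ∈ Θ, MemLp (fun z : D × D => h z.1 z.2 θ) 2 Q
  contDiff : ∀ x₁ x₂, ContDiffOn ℝ 1 (fun θ => h x₁ x₂ θ) Θ
  dominated : ∀ M ⊆ Θ, IsCompact M → ∃ hbar : D × D → ℝ, Integrable hbar Q ∧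
    ∀ θ ∈ M, ∀ z : D × D, ‖dh Θ h z.1 z.2 θ‖ ≤ hbar z
  invertible : IsUnit (meanJacobian Θ Q h θ₀)

/-- For each compact `K ⊆ Θ` there is a compact `M ⊆ Θ` such that every point of `K` is joined, by a curve in
`M` of length at most some `L` (depending only on `K`), to a point of a finite subset of `M`.
Open sets and convex sets have this property. -/
def RectifiablyAccessible (Θ : Set (EuclideanSpace ℝ (Fin p))) : Prop :=
  ∀ K ⊆ Θ, IsCompact K → ∃ M ⊆ Θ, IsCompact M ∧ ∃ F ⊆ M, F.Finite ∧ ∃ L : ℝ≥0,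
    ∀ θ ∈ K, ∃ γ : ℝ → EuclideanSpace ℝ (Fin p), LipschitzOnWith L γ (Icc 0 1) ∧
      MapsTo γ (Icc 0 1) M ∧ γ 0 ∈ F ∧ γ 1 = θ

end Conditions

end Longitudinal

end

/-! Only the sampled paths $(Y^i_0,Y^i_\Delta,\dots,Y^i_{m\Delta})$ enter the problem. They are
i.i.d. and by invariance each consecutive pair has law $Q$, so $G_n(\theta)$ is an average of i.i.d.
path sums. At $\theta_0$ the terms of a path sum are martingale differences, hence centred and
orthogonal, and the path sum has covariance $m\,Q(hh^*)$. The law of large numbers makes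
$G_n(\theta_0)$ small, and the scalar central limit theorem applied in every direction gives its
Gaussian fluctuations.

Locally, everything rests on `eventuallyAS_approximatesLinearOn`: for each $c>0$ there is a ball
around $\theta_0$ on which, almost surely for all large $n$, $G_n$ minus the invertible linear map
$A=m\,Q(\partial_\theta h(\theta_0))$ is $c$-Lipschitz. Deterministic inverse function arguments
then give a root near $\theta_0$ (`ApproximatesLinearOn.exists_root`), its uniqueness in a fixed
ball (`ApproximatesLinearOn.root_unique`), and a distance to the Newton step $-A^{-1}G_n(\theta_0)$
which is a small multiple of the step itself (`ApproximatesLinearOn.norm_root_sub_le`). So any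
weakly consistent sequence of roots inherits the limit law of $\sqrt n$ times the Newton step;
`AsymptoticallyLinear` collects what this needs.

A root must also be chosen measurably. `exists_isMeasurableEst_selector` does this for the completed
data $\sigma$-field, by reduction to Borel sets over Cantor space and inner approximation of
analytic sets by images of compact sets.

For part (B), Wald's compactness argument (`eventuallyAS_average_ne_zero`) excludes roots in a
compact set away from $\theta_0$. It needs an integrable envelope of $h$ itself, obtained by
integrating the bound on $\partial_\theta h$ along curves of bounded length starting in a finite
set. Compactness of $\Theta$, or the minimizing property of centred estimators, confines the
estimator to a compact set, which yields weak consistency. -/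

noncomputable section

namespace Longitudinal

set_option linter.unusedSectionVars false

/-! ### Measurable selection up to null sets -/

section Selection

/-- A continuous injection of Baire space into the line. -/
lemma exists_continuous_injective_baire_real :
    ∃ ι : (ℕ → ℕ) → ℝ, Continuous ι ∧ Function.Injective ι := by
  -- The indicator of the graph of `y`, read through the pairing bijection.
  let e : (ℕ → ℕ) → ℕ → Bool := fun y k => decide (y (Nat.unpair k).1 = (Nat.unpair k).2)
  have he : Function.Injective e := by
    intro y z hyz
    funext i
    have := congrFun hyz (Nat.pair i (y i))
    simp only [e, Nat.unpair_pair, decide_true] at this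
    exact (of_decide_eq_true this.symm).symm
  have hec : Continuous e := by
    refine continuous_pi fun k => ?_
    exact (continuous_of_discreteTopology (f := fun a : ℕ => decide (a = (Nat.unpair k).2))).comp
      (continuous_apply _)
  -- Uniform summability gives continuity; the ratio $1/3<1/2$ makes the function injective.
  have hc : Continuous (Cardinal.cantorFunction (1 / 3)) := by
    unfold Cardinal.cantorFunction
    refine continuous_tsum (u := fun n => (1 / 3 : ℝ) ^ n) (fun n => ?_)
      (summable_geometric_of_lt_one (by norm_num) (by norm_num)) fun n f => ?_
    · exact (continuous_of_discreteTopology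
        (f := fun b : Bool => cond b ((1 / 3 : ℝ) ^ n) 0)).comp (continuous_apply n)
    · unfold Cardinal.cantorFunctionAux
      cases f n <;> simp
  exact ⟨_, hc.comp hec,
    (Cardinal.cantorFunction_injective (by norm_num) (by norm_num)).comp he⟩

/-- Measurable selection from the fibres of a continuous map on a compact subset of Baire space. -/
lemma exists_measurable_section_of_isCompact {X : Type*} [TopologicalSpace X] [T2Space X]
    [MeasurableSpace X] [BorelSpace X] {g : (ℕ → ℕ) → X} (hg : Continuous g) {K : Set (ℕ → ℕ)}
    (hK : IsCompact K) :
    ∃ s : X → ℕ → ℕ, Measurable s ∧ ∀ x ∈ g '' K, s x ∈ K ∧ g (s x) = x := by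
  classical
  obtain ⟨ι, hι, hinj⟩ := exists_continuous_injective_baire_real
  -- Select in each compact fibre a point with the least value of `ι`. The sublevel sets of the
  -- selection are then images of compact sets, which gives measurability.
  have hmin : ∀ x, x ∈ g '' K → ∃ y ∈ K, g y = x ∧ ∀ z ∈ K, g z = x → ι y ≤ ι z := by
    rintro x ⟨y, hy, rfl⟩
    have hc : IsCompact (K ∩ g ⁻¹' {g y}) := hK.inter_right (isClosed_singleton.preimage hg)
    obtain ⟨w, hw, hwm⟩ := hc.exists_isMinOn ⟨y, hy, rfl⟩ hι.continuousOn
    exact ⟨w, hw.1, hw.2, fun z hz hgz => hwm ⟨hz, hgz⟩⟩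
  choose! s hsK hgs hsm using hmin
  let t : X → ℕ → ℕ := fun x => if x ∈ g '' K then s x else 0
  have hKm : MeasurableSet (g '' K) := (hK.image hg).isClosed.measurableSet
  refine ⟨t, ?_, fun x hx => ?_⟩
  · have hemb : MeasurableEmbedding ι := hι.measurableEmbedding hinj
    rw [← hemb.measurable_comp_iff]
    have hcomp : ι ∘ t = fun x => if x ∈ g '' K then ι (s x) else ι 0 := by
      funext x; by_cases hx : x ∈ g '' K <;> simp only [t, Function.comp, hx, if_true, if_false]
    rw [hcomp]
    refine measurable_of_Iic fun a => ?_
    have : (fun x => if x ∈ g '' K then ι (s x) else ι 0) ⁻¹' Iic a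
        = (g '' (K ∩ ι ⁻¹' Iic a)) ∪ ((g '' K)ᶜ ∩ {_x | ι 0 ≤ a}) := by
      ext x
      by_cases hx : x ∈ g '' K
      · simp only [mem_preimage, hx, if_true, mem_Iic, mem_union, mem_inter_iff, mem_compl_iff,
          not_true_eq_false, false_and, or_false]
        constructor
        · intro hle
          exact ⟨s x, ⟨hsK x hx, hle⟩, hgs x hx⟩
        · rintro ⟨y, ⟨hy, hya⟩, rfl⟩
          exact (hsm _ hx y hy rfl).trans hya
      · have hx' : x ∉ g '' (K ∩ ι ⁻¹' Iic a) := fun h' => hx (image_mono inter_subset_left h')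
        simp only [mem_preimage, hx, if_false, mem_Iic, mem_union, hx', false_or, mem_inter_iff,
          mem_compl_iff, not_false_eq_true, true_and, mem_ofPred_eq]
    rw [this]
    exact ((hK.inter_right (isClosed_Iic.preimage hι)).image hg).isClosed.measurableSet.union
      (hKm.compl.inter (MeasurableSet.const _))
  · simp only [t, hx, if_true]
    exact ⟨hsK x hx, hgs x hx⟩

/-- Compact sets in Baire space: sequences bounded by a given one. -/
lemma isCompact_baire_Iic (n : ℕ → ℕ) : IsCompact {y : ℕ → ℕ | ∀ i, y i ≤ n i} := by
  have : {y : ℕ → ℕ | ∀ i, y i ≤ n i} = Set.pi univ fun i => Iic (n i) := by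
    ext y; simp [Pi.le_def]
  rw [this]
  exact isCompact_univ_pi fun i => (Set.finite_Iic _).isCompact

/-- Inner approximation of an analytic set by continuous images of compact sets. -/
lemma exists_isCompact_measure_image_ge {X : Type*} [TopologicalSpace X] [T2Space X]
    [MeasurableSpace X] [BorelSpace X] {g : (ℕ → ℕ) → X} (hg : Continuous g) (μ : Measure X)
    [IsFiniteMeasure μ] {a : ℝ≥0∞} (ha : a < μ (range g)) :
    ∃ K : Set (ℕ → ℕ), IsCompact K ∧ a ≤ μ (g '' K) := by
  -- boxes in which the first coordinates are bounded
  let C : (ℕ → ℕ) → ℕ → Set (ℕ → ℕ) := fun n k => {y | ∀ i < k, y i ≤ n i}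
  -- Continuity from below holds for monotone unions of arbitrary sets, so the analytic images need
  -- not be known to be measurable.
  have step : ∀ S : Set (ℕ → ℕ), ∀ k : ℕ, a < μ (g '' S) →
      ∃ N : ℕ, a < μ (g '' (S ∩ {y | y k ≤ N})) := by
    intro S k hS
    have hmono : Monotone fun N : ℕ => g '' (S ∩ {y | y k ≤ N}) := fun N N' hN =>
      image_mono (inter_subset_inter_right _ fun y (hy : y k ≤ N) => hy.trans hN)
    have hU : ⋃ N : ℕ, g '' (S ∩ {y | y k ≤ N}) = g '' S := by
      rw [← image_iUnion, ← inter_iUnion]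
      congr 1
      refine inter_eq_left.2 fun y _ => mem_iUnion.2 ⟨y k, by simp⟩
    rw [← hU, hmono.measure_iUnion] at hS
    exact lt_iSup_iff.1 hS
  let st : ℕ → {S : Set (ℕ → ℕ) // a < μ (g '' S)} := fun k =>
    Nat.rec ⟨univ, by rwa [image_univ]⟩
      (fun k S => ⟨S.1 ∩ {y | y k ≤ (step S.1 k S.2).choose}, (step S.1 k S.2).choose_spec⟩) k
  let n : ℕ → ℕ := fun k => (step (st k).1 k (st k).2).choose
  have hst : ∀ k, (st k).1 = C n k := by
    intro k
    induction k with
    | zero => ext y; simp [st, C]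
    | succ k ih =>
      have : (st (k + 1)).1 = (st k).1 ∩ {y | y k ≤ n k} := rfl
      rw [this, ih]
      ext y
      simp only [C, mem_inter_iff, mem_ofPred_eq, Nat.lt_succ_iff_lt_or_eq]
      constructor
      · rintro ⟨h1, h2⟩ i (hi | rfl)
        exacts [h1 i hi, h2]
      · exact fun h' => ⟨fun i hi => h' i (Or.inl hi), h' k (Or.inr rfl)⟩
  have hC : ∀ k, a < μ (g '' C n k) := fun k => hst k ▸ (st k).2
  let K := {y : ℕ → ℕ | ∀ i, y i ≤ n i}
  have hK : IsCompact K := isCompact_baire_Iic n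
  refine ⟨K, hK, ?_⟩
  -- The boxes shrink to `K` so tightly that every open set containing `K` contains one of them.
  have hinter : ⋂ k, closure (g '' C n k) ⊆ g '' K := by
    intro x hx
    by_contra hxK
    obtain ⟨U, V, hU, hV, hKU, hxV, hUV⟩ := SeparatedNhds.of_isCompact_isCompact (hK.image hg)
      (isCompact_singleton (x := x)) (disjoint_singleton_right.2 hxK)
    have hsub : ∃ k, C n k ⊆ g ⁻¹' U := by
      by_contra! hno
      have hno' : ∀ k, ∃ y ∈ C n k, y ∉ g ⁻¹' U := fun k => not_subset.1 (hno k)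
      choose y hyC hyU using hno'
      -- Truncation moves the points into the compact `K`. It leaves coordinate `i` of `y k`
      -- unchanged once `k > i`, so the untruncated subsequence has the same limit.
      have hz : ∀ k, (fun i => min (y k i) (n i)) ∈ K := fun k i => min_le_right _ _
      obtain ⟨z, hzK, φ, hφ, hlim⟩ := hK.tendsto_subseq hz
      have hlim' : Tendsto (fun k => y (φ k)) atTop (𝓝 z) := by
        rw [tendsto_pi_nhds] at hlim ⊢
        intro i
        refine (hlim i).congr' ?_
        filter_upwards [eventually_gt_atTop i] with k hk
        exact min_eq_left (hyC (φ k) i (hk.trans_le hφ.le_apply))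
      have := ((hU.preimage hg).isClosed_compl).mem_of_tendsto hlim'
        (Eventually.of_forall fun k => hyU (φ k))
      exact this (hKU (mem_image_of_mem g hzK))
    obtain ⟨k, hk⟩ := hsub
    have hxk : x ∈ closure U := closure_mono (image_subset_iff.2 hk) (mem_iInter.1 hx k)
    exact (hUV.closure_left hV).le_bot ⟨hxk, hxV rfl⟩
  have hanti : Antitone fun k => closure (g '' C n k) := fun k l hkl =>
    closure_mono (image_mono fun y hy i hi => hy i (hi.trans_le hkl))
  have hlim := tendsto_measure_iInter_atTop (μ := μ)
    (fun k => (isClosed_closure (s := g '' C n k)).measurableSet.nullMeasurableSet) hanti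
    ⟨0, measure_ne_top _ _⟩
  refine (ge_of_tendsto' hlim fun k => ?_).trans (measure_mono hinter)
  exact (hC k).le.trans (measure_mono subset_closure)


/-- A measurable set in a product with a Polish factor admits a selector that is measurable and
defined almost everywhere on its projection. -/
lemma exists_measurable_selector_ae {X Θ : Type*} [TopologicalSpace X] [PolishSpace X]
    [MeasurableSpace X] [BorelSpace X] [MeasurableSpace Θ] [StandardBorelSpace Θ] [Nonempty Θ]
    (μ : Measure X) [IsFiniteMeasure μ] {S : Set (X × Θ)} (hS : MeasurableSet S) :
    ∃ U : Set X, MeasurableSet U ∧ U ⊆ Prod.fst '' S ∧ μ (Prod.fst '' S \ U) = 0 ∧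
      ∃ σ : X → Θ, Measurable σ ∧ ∀ x ∈ U, (x, σ x) ∈ S := by
  classical
  let _ := upgradeStandardBorel Θ
  have hSa := hS.analyticSet
  rw [AnalyticSet] at hSa
  rcases hSa with rfl | ⟨G, hG, hGS⟩
  · exact ⟨∅, MeasurableSet.empty, empty_subset _, by simp, fun _ => Classical.arbitrary Θ,
      measurable_const, fun x hx => hx.elim⟩
  let g : (ℕ → ℕ) → X := fun y => (G y).1
  have hg : Continuous g := hG.fst
  have hrange : Prod.fst '' S = range g := by rw [← hGS, ← range_comp]; rfl
  rw [hrange]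
  have hK : ∀ k : ℕ, ∃ K : Set (ℕ → ℕ), IsCompact K ∧
      μ (range g) ≤ μ (g '' K) + (k + 1 : ℝ≥0∞)⁻¹ := by
    intro k
    rcases eq_or_ne (μ (range g)) 0 with h0 | h0
    · exact ⟨∅, isCompact_empty, by simp [h0]⟩
    · have hlt : μ (range g) - (k + 1 : ℝ≥0∞)⁻¹ < μ (range g) :=
        ENNReal.sub_lt_self (measure_ne_top _ _) h0
          (ENNReal.inv_ne_zero.2 (by exact_mod_cast ENNReal.natCast_ne_top (k + 1)))
      obtain ⟨K, hK, hle⟩ := exists_isCompact_measure_image_ge hg μ hlt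
      exact ⟨K, hK, tsub_le_iff_right.1 hle⟩
  choose K hKc hKμ using hK
  choose s hs hsK using fun k => exists_measurable_section_of_isCompact hg (hKc k)
  have hKm : ∀ k, MeasurableSet (g '' K k) := fun k => ((hKc k).image hg).isClosed.measurableSet
  let U := ⋃ k, g '' K k
  have hU : MeasurableSet U := MeasurableSet.iUnion hKm
  have hUr : U ⊆ range g := iUnion_subset fun k => image_subset_range _ _
  refine ⟨U, hU, hUr, ?_, ?_⟩
  · have hle : μ (range g) ≤ μ U := by
      have hlim : Tendsto (fun k : ℕ => μ U + (k + 1 : ℝ≥0∞)⁻¹) atTop (𝓝 (μ U + 0)) := by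
        refine tendsto_const_nhds.add ?_
        have := (tendsto_add_atTop_iff_nat 1).2 ENNReal.tendsto_inv_nat_nhds_zero
        simpa using this
      rw [add_zero] at hlim
      exact ge_of_tendsto' hlim fun k => (hKμ k).trans
        (by gcongr; exact subset_iUnion (fun k => g '' K k) k)
    rw [measure_sdiff hUr hU.nullMeasurableSet (measure_ne_top _ _)]
    exact tsub_eq_zero_of_le hle
  -- Glue the sections over the countably many compact images by using the first image that contains
  -- the point.
  · let N : X → ℕ := fun x => if h : ∃ k, x ∈ g '' K k then Nat.find h else 0
    have hN : Measurable N := by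
      refine measurable_to_countable' fun k => ?_
      have : N ⁻¹' {k} = (g '' K k \ ⋃ j < k, g '' K j) ∪ (Uᶜ ∩ {_x | k = 0}) := by
        ext x
        by_cases hx : ∃ k, x ∈ g '' K k
        · have hxU : x ∈ U := mem_iUnion.2 hx
          have : N x = Nat.find hx := dif_pos hx
          simp only [mem_preimage, mem_singleton_iff, this, Nat.find_eq_iff, mem_union, Set.mem_sdiff,
            mem_iUnion, not_exists, mem_inter_iff, mem_compl_iff, hxU, not_true_eq_false,
            false_and, or_false]
        · have hxU : x ∉ U := fun h' => hx (mem_iUnion.1 h')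
          have : N x = 0 := dif_neg hx
          have hxk : x ∉ g '' K k := fun h' => hx ⟨k, h'⟩
          simp only [mem_preimage, mem_singleton_iff, this, mem_union, Set.mem_sdiff, hxk, false_and,
            false_or, mem_inter_iff, mem_compl_iff, hxU, not_false_eq_true, true_and,
            mem_ofPred_eq, eq_comm]
      rw [this]
      exact ((hKm k).diff (MeasurableSet.biUnion (to_countable _) fun j _ => hKm j)).union
        (hU.compl.inter (MeasurableSet.const _))
    refine ⟨fun x => (G (s (N x) x)).2, ?_, fun x hx => ?_⟩
    · refine hG.measurable.snd.comp ?_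
      exact measurable_from_prod_countable_right (f := fun q : ℕ × X => s q.1 q.2) hs
        |>.comp (hN.prodMk measurable_id)
    · have hx' : ∃ k, x ∈ g '' K k := mem_iUnion.1 hx
      have hNx : N x = Nat.find hx' := dif_pos hx'
      have hmem : x ∈ g '' K (N x) := hNx ▸ Nat.find_spec hx'
      have := (hsK (N x) x hmem).2
      rw [← hGS]
      exact ⟨s (N x) x, Prod.ext this rfl⟩

/-- A set measurable for a product `σ`-algebra is the preimage of a Borel set under a measurable
map of the first coordinate to Cantor space. -/
lemma exists_cantor_factor_of_measurableSet_prod {Ω Θ : Type*} [MeasurableSpace Ω]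
    [MeasurableSpace Θ] {S : Set (Ω × Θ)} (hS : MeasurableSet S) :
    ∃ φ : Ω → ℕ → Bool, Measurable φ ∧ ∃ B : Set ((ℕ → Bool) × Θ), MeasurableSet B ∧
      S = Prod.map φ id ⁻¹' B := by
  classical
  rw [← generateFrom_prod] at hS
  induction S, hS using MeasurableSpace.generateFrom_induction with
  | hC S hS _ =>
    obtain ⟨A, hA, C, hC, rfl⟩ := hS
    refine ⟨fun ω _ => decide (ω ∈ A), ?_, {q | q.1 0 = true} ∩ Prod.snd ⁻¹' C, ?_, ?_⟩
    · exact measurable_pi_lambda _ fun _ => measurable_to_bool (by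
        have : (fun c => decide (c ∈ A)) ⁻¹' {true} = A := by ext; simp
        rw [this]; exact hA)
    · refine MeasurableSet.inter ?_ (measurable_snd hC)
      exact measurableSet_eq_fun ((measurable_pi_apply 0).comp measurable_fst) measurable_const
    · ext ⟨ω, θ⟩; simp
  | empty => exact ⟨fun _ _ => true, measurable_const, ∅, MeasurableSet.empty, by simp⟩
  | compl S _ ih =>
    obtain ⟨φ, hφ, B, hB, rfl⟩ := ih
    exact ⟨φ, hφ, Bᶜ, hB.compl, rfl⟩
  | iUnion S _ ih =>
    choose φ hφ B hB hSB using ih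
    -- Countably many points of Cantor space are interleaved into one; `π i` reads off the `i`-th.
    let ψ : Ω → ℕ → Bool := fun ω k => φ (Nat.unpair k).1 ω (Nat.unpair k).2
    let π : ℕ → (ℕ → Bool) → ℕ → Bool := fun i a j => a (Nat.pair i j)
    have hπ : ∀ i, Measurable (π i) := fun i =>
      measurable_pi_lambda _ fun j => measurable_pi_apply _
    refine ⟨ψ, measurable_pi_lambda _ fun k => (measurable_pi_apply _).comp (hφ _),
      ⋃ i, Prod.map (π i) id ⁻¹' B i, MeasurableSet.iUnion fun i =>
        ((hπ i).prodMap measurable_id) (hB i), ?_⟩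
    rw [preimage_iUnion]
    refine iUnion_congr fun i => ?_
    rw [hSB i, ← preimage_comp]
    congr 1
    funext q
    exact Prod.ext (funext fun j => by simp [ψ, π]) rfl

/-- **Measurable selection**: the projection of a product measurable set, and a selector on it, are
measurable for the completed `σ`-algebra. -/
lemma exists_isMeasurableEst_selector {Ω : Type*} {𝒢 mΩ : MeasurableSpace Ω} (Pr : Measure Ω)
    [IsFiniteMeasure Pr] {p : ℕ} {Θ : Set (EuclideanSpace ℝ (Fin p))} (hΘ : MeasurableSet Θ)
    (h𝒢 : 𝒢 ≤ mΩ) {S : Set (Ω × Θ)}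
    (hS : MeasurableSet[𝒢.prod inferInstance] S) :
    ∃ T : Ω → Option Θ, IsMeasurableEst (eventuallyMeasurableSpace 𝒢 (ae Pr)) T ∧
      (∀ ω θ, T ω = some θ → (ω, θ) ∈ S) ∧ ∀ ω, (∃ θ, (ω, θ) ∈ S) → T ω ≠ none := by
  classical
  rcases isEmpty_or_nonempty Θ with hemp | hne
  · refine ⟨fun _ => none, fun B _ => ?_, by simp, fun ω ⟨θ, _⟩ => isEmptyElim θ⟩
    convert MeasurableSet.empty
    ext ω; simp
  have : StandardBorelSpace Θ := hΘ.standardBorel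
  obtain ⟨φ, hφ, B, hB, rfl⟩ := @exists_cantor_factor_of_measurableSet_prod Ω Θ 𝒢 _ S hS
  have hφ' : Measurable φ := hφ.mono h𝒢 le_rfl
  have : PolishSpace Bool := (Continuous.isClosedEmbedding
    (f := fun b : Bool => cond b 1 (0 : ℕ)) continuous_of_discreteTopology
    (by decide)).polishSpace
  obtain ⟨U, hU, hUB, hnull, σ, hσ, hσB⟩ := exists_measurable_selector_ae (Pr.map φ) hB
  -- Off `U` the root comes from an arbitrary choice, so that `T` is defined on the whole
  -- projection. This affects only a null set, which the completion absorbs.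
  let T : Ω → Option Θ := fun ω =>
    if φ ω ∈ U then some (σ (φ ω)) else
      if h : ∃ θ, (φ ω, θ) ∈ B then some h.choose else none
  refine ⟨T, fun A hA => ?_, fun ω θ hT => ?_, fun ω hω => ?_⟩
  · refine EventuallyMeasurableSet.congr (m := 𝒢) (l := ae Pr)
      (t := φ ⁻¹' (U ∩ σ ⁻¹' A))
      (MeasurableSet.eventuallyMeasurableSet (hφ (hU.inter (hσ hA)))) ?_
    have hae : ∀ᵐ ω ∂Pr, φ ω ∉ Prod.fst '' B \ U :=
      ae_of_ae_map hφ'.aemeasurable (measure_eq_zero_iff_ae_notMem.1 hnull)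
    filter_upwards [hae] with ω hω
    apply propext
    change (∃ θ ∈ A, T ω = some θ) ↔ (φ ω ∈ U ∧ σ (φ ω) ∈ A)
    by_cases hωU : φ ω ∈ U
    · simp [T, hωU]
    · have : ¬ ∃ θ, (φ ω, θ) ∈ B := fun ⟨θ, hθ⟩ => hω ⟨⟨_, hθ, rfl⟩, hωU⟩
      have hT : T ω = none := by simp only [T, hωU, if_false, this, dif_neg, not_false_eq_true]
      simp [hT, hωU]
  · change (φ ω, θ) ∈ B
    by_cases hωU : φ ω ∈ U
    · simp only [T, hωU, if_true, Option.some.injEq] at hT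
      exact hT ▸ hσB _ hωU
    · by_cases hex : ∃ θ, (φ ω, θ) ∈ B
      · simp only [T, hωU, if_false, hex, dif_pos, Option.some.injEq] at hT
        exact hT ▸ hex.choose_spec
      · simp only [T, hωU, if_false, hex, dif_neg, not_false_eq_true, reduceCtorEq] at hT
  · have hex : ∃ θ, (φ ω, θ) ∈ B := hω
    by_cases hωU : φ ω ∈ U
    · simp [T, hωU]
    · simp only [T, hωU, if_false, hex, dif_pos, ne_eq, reduceCtorEq, not_false_eq_true]

end Selection

/-! ### Laws and moments of discretely observed Markov paths -/

section Markov

variable {Ω D : Type*} [MeasurableSpace Ω] [MeasurableSpace D] {Pr : Measure Ω}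
  [IsProbabilityMeasure Pr] {Y : ℝ≥0 → Ω → D} {κ : ℝ≥0 → Kernel D D} {ν : Measure D}

lemma IsMarkovProcess.past_le (hY : IsMarkovProcess Pr Y κ ν) (s : ℝ≥0) :
    (⨆ u : Set.Iic s, MeasurableSpace.comap (Y u) inferInstance) ≤ ‹MeasurableSpace Ω› :=
  iSup_le fun u => (hY.measurable u).comap_le

lemma measurable_past (Y : ℝ≥0 → Ω → D) {s u : ℝ≥0} (hu : u ≤ s) :
    Measurable[⨆ u : Set.Iic s, MeasurableSpace.comap (Y u) inferInstance] (Y u) :=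
  (comap_measurable (Y u)).mono
    (le_iSup (fun u : Set.Iic s => MeasurableSpace.comap (Y u) inferInstance) ⟨u, hu⟩) le_rfl

/-- Joint law of a functional of the past and the state a time `t` later. -/
lemma IsMarkovProcess.map_prodMk (hY : IsMarkovProcess Pr Y κ ν) [∀ t, IsMarkovKernel (κ t)]
    {E : Type*} [MeasurableSpace E] {s : ℝ≥0} (t : ℝ≥0) {W : Ω → E}
    (hW : Measurable[⨆ u : Set.Iic s, MeasurableSpace.comap (Y u) inferInstance] W)
    {π : E → D} (hπ : Measurable π) (hWπ : ∀ ω, π (W ω) = Y s ω) :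
    Pr.map (fun ω => (W ω, Y (s + t) ω)) = Pr.map W ⊗ₘ (κ t).comap π hπ := by
  have hWm : Measurable W := hW.mono (hY.past_le s) le_rfl
  have : IsProbabilityMeasure (Pr.map W) := Measure.isProbabilityMeasure_map hWm.aemeasurable
  have : IsProbabilityMeasure (Pr.map fun ω => (W ω, Y (s + t) ω)) :=
    Measure.isProbabilityMeasure_map (hWm.prodMk (hY.measurable _)).aemeasurable
  -- On a rectangle the claim is the Markov property integrated over the past event `W ⁻¹' B`.
  refine Measure.ext_prod fun {B A} hB hA => ?_
  rw [Measure.map_apply (hWm.prodMk (hY.measurable _)) (hB.prod hA),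
    Measure.compProd_apply_prod hB hA,
    setLIntegral_map hB (Kernel.measurable_coe _ hA) hWm]
  have hYA : MeasurableSet (Y (s + t) ⁻¹' A) := hY.measurable _ hA
  have hset := setIntegral_condExp (μ := Pr) (hY.past_le s)
    (f := (Y (s + t) ⁻¹' A).indicator fun _ => (1 : ℝ)) ((integrable_const _).indicator hYA)
    (hW hB)
  rw [setIntegral_congr_ae (g := fun ω => (κ t (Y s ω)).real A) (hWm hB)
    ((hY.markov s t A hA).mono fun ω hω _ => hω),
    setIntegral_indicator hYA, setIntegral_const, smul_eq_mul, mul_one] at hset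
  have hmeas : Measurable fun ω => κ t (Y s ω) A :=
    (Kernel.measurable_coe _ hA).comp (hY.measurable s)
  have hlint : ∫⁻ ω in W ⁻¹' B, κ t (Y s ω) A ∂Pr
      = ENNReal.ofReal (∫ ω in W ⁻¹' B, (κ t (Y s ω)).real A ∂Pr) := by
    rw [ofReal_integral_eq_lintegral_ofReal]
    · refine lintegral_congr fun ω => ?_
      rw [Measure.real, ENNReal.ofReal_toReal (measure_ne_top _ _)]
    · refine Integrable.of_bound (C := 1) hmeas.ennreal_toReal.aestronglyMeasurable
        (Eventually.of_forall fun ω => ?_)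
      rw [Real.norm_eq_abs, abs_of_nonneg measureReal_nonneg]
      exact measureReal_le_one
    · exact Eventually.of_forall fun ω => measureReal_nonneg
  simp only [Kernel.comap_apply, hWπ]
  rw [hlint, hset, ofReal_measureReal]
  rfl

/-- Under an invariant initial law, all the one-dimensional marginals agree. -/
lemma IsMarkovProcess.map_eq (hY : IsMarkovProcess Pr Y κ ν) [∀ t, IsMarkovKernel (κ t)]
    (hν : ∀ t, Kernel.Invariant (κ t) ν) (t : ℝ≥0) : Pr.map (Y t) = ν := by
  have : IsProbabilityMeasure ν :=
    hY.initial ▸ Measure.isProbabilityMeasure_map (hY.measurable 0).aemeasurable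
  have h0 := hY.map_prodMk (s := 0) t (measurable_past Y le_rfl) measurable_id fun ω => rfl
  rw [zero_add, hY.initial] at h0
  have h1 := congrArg Measure.snd h0
  rw [Measure.snd_map_prodMk (hY.measurable 0), Kernel.comap_id, Measure.snd_compProd] at h1
  rw [h1]
  exact hν t

lemma IsMarkovProcess.map_pair_eq (hY : IsMarkovProcess Pr Y κ ν) [∀ t, IsMarkovKernel (κ t)]
    (hν : ∀ t, Kernel.Invariant (κ t) ν) (s t : ℝ≥0) :
    Pr.map (fun ω => (Y s ω, Y (s + t) ω)) = ν ⊗ₘ κ t := by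
  have h0 := hY.map_prodMk t (measurable_past Y (le_refl s)) measurable_id fun ω => rfl
  rwa [Kernel.comap_id, hY.map_eq hν] at h0

/-- The discretely observed path of a process. -/
def skeleton (Y : ℝ≥0 → Ω → D) (Δ : ℝ≥0) (k : ℕ) (ω : Ω) : Fin (k + 1) → D :=
  fun j => Y ((j : ℕ) * Δ) ω

lemma IsMarkovProcess.measurable_skeleton (hY : IsMarkovProcess Pr Y κ ν) (Δ : ℝ≥0) (k : ℕ) :
    Measurable (skeleton Y Δ k) :=
  measurable_pi_lambda _ fun _ => hY.measurable _

/-- The initial law and the kernels determine the law of the discretely observed path. -/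
lemma IsMarkovProcess.map_skeleton_eq {Y' : ℝ≥0 → Ω → D} (hY : IsMarkovProcess Pr Y κ ν)
    (hY' : IsMarkovProcess Pr Y' κ ν) [∀ t, IsMarkovKernel (κ t)] (Δ : ℝ≥0) (k : ℕ) :
    Pr.map (skeleton Y Δ k) = Pr.map (skeleton Y' Δ k) := by
  induction k with
  | zero =>
    have : ∀ Z : ℝ≥0 → Ω → D, IsMarkovProcess Pr Z κ ν →
        Pr.map (skeleton Z Δ 0) = ν.map fun x _ => x := by
      intro Z hZ
      have hc : Measurable fun (x : D) (_ : Fin 1) => x :=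
        measurable_pi_lambda _ fun _ => measurable_id
      rw [← hZ.initial, Measure.map_map hc (hZ.measurable 0)]
      congr 1
      funext ω j
      simp [skeleton]
    rw [this Y hY, this Y' hY']
  | succ k ih =>
    let F : (Fin (k + 1) → D) × D → Fin (k + 2) → D := fun q => Fin.snoc (α := fun _ => D) q.1 q.2
    have hF : Measurable F := by
      refine measurable_pi_lambda _ fun j => ?_
      refine Fin.lastCases ?_ (fun i => ?_) j
      · simpa [F] using measurable_snd
      · simp only [F, Fin.snoc_castSucc]
        exact (measurable_pi_apply i).comp measurable_fst
    -- The next state is drawn from `κ Δ` at the last observed one, so the path law satisfies a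
    -- recursion that depends only on `κ`.
    have key : ∀ Z : ℝ≥0 → Ω → D, IsMarkovProcess Pr Z κ ν →
        Pr.map (skeleton Z Δ (k + 1)) = (Pr.map (skeleton Z Δ k) ⊗ₘ
          (κ Δ).comap (fun x => x (Fin.last k)) (measurable_pi_apply _)).map F := by
      intro Z hZ
      have hpast : Measurable[⨆ u : Set.Iic ((k : ℝ≥0) * Δ),
          MeasurableSpace.comap (Z u) inferInstance] (skeleton Z Δ k) := by
        refine @measurable_pi_lambda _ _ _ (_) _ _ fun j => measurable_past Z ?_
        gcongr
        exact_mod_cast Nat.lt_succ_iff.1 j.2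
      rw [← hZ.map_prodMk Δ hpast (measurable_pi_apply (Fin.last k)) fun ω => rfl,
        Measure.map_map hF ((hZ.measurable_skeleton Δ k).prodMk (hZ.measurable _))]
      congr 1
      funext ω j
      refine Fin.lastCases ?_ (fun i => ?_) j
      · simp only [skeleton, F, Function.comp, Fin.snoc_last, Fin.val_last]
        congr 1
        push_cast
        ring
      · simp [skeleton, F]
    rw [key Y hY, key Y' hY', ih]

/-- The sum of a function over the consecutive pairs of a path. -/
def pathSum {F : Type*} [AddCommMonoid F] {m : ℕ} (u : D → D → F) (x : Fin (m + 1) → D) : F :=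
  ∑ j : Fin m, u (x j.castSucc) (x j.succ)

lemma pathSum_skeleton {F : Type*} [AddCommMonoid F] {m : ℕ} (u : D → D → F) (Δ : ℝ≥0) (ω : Ω) :
    pathSum u (skeleton Y Δ m ω) = ∑ j ∈ Finset.range m,
      u (Y ((j : ℝ≥0) * Δ) ω) (Y (((j + 1 : ℕ) : ℝ≥0) * Δ) ω) := by
  rw [Finset.sum_range]
  rfl

lemma measurable_pathSum {F : Type*} [AddCommMonoid F] [MeasurableSpace F] [MeasurableAdd₂ F]
    {m : ℕ} {u : D → D → F} (hu : Measurable fun z : D × D => u z.1 z.2) :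
    Measurable fun x : Fin (m + 1) → D => pathSum u x :=
  Finset.measurable_sum _ fun j _ => hu.comp (f := fun x : Fin (m + 1) → D =>
    (x j.castSucc, x j.succ)) ((measurable_pi_apply _).prodMk (measurable_pi_apply _))

variable {Δ : ℝ≥0}

lemma IsMarkovProcess.measurePreserving_pair (hY : IsMarkovProcess Pr Y κ ν)
    [∀ t, IsMarkovKernel (κ t)] (hν : ∀ t, Kernel.Invariant (κ t) ν) (j : ℕ) :
    MeasurePreserving (fun ω => (Y ((j : ℝ≥0) * Δ) ω, Y (((j + 1 : ℕ) : ℝ≥0) * Δ) ω)) Pr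
      (ν ⊗ₘ κ Δ) := by
  refine ⟨(hY.measurable _).prodMk (hY.measurable _), ?_⟩
  rw [← hY.map_pair_eq hν ((j : ℝ≥0) * Δ) Δ]
  congr 1
  funext ω
  simp only [Nat.cast_add, Nat.cast_one, add_mul, one_mul]

lemma IsMarkovProcess.measurePreserving_proj (hY : IsMarkovProcess Pr Y κ ν)
    [∀ t, IsMarkovKernel (κ t)] (hν : ∀ t, Kernel.Invariant (κ t) ν) {m : ℕ} (j : Fin m) :
    MeasurePreserving (fun x : Fin (m + 1) → D => (x j.castSucc, x j.succ))
      (Pr.map (skeleton Y Δ m)) (ν ⊗ₘ κ Δ) := by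
  refine ⟨by fun_prop, ?_⟩
  rw [Measure.map_map (by fun_prop) (hY.measurable_skeleton Δ m)]
  exact (hY.measurePreserving_pair hν j).map_eq

/-- Martingale differences at different times are orthogonal. -/
lemma IsMarkovProcess.integral_mul_eq_zero (hY : IsMarkovProcess Pr Y κ ν)
    [∀ t, IsMarkovKernel (κ t)] (hν : ∀ t, Kernel.Invariant (κ t) ν) {u v : D → D → ℝ}
    (hum : Measurable fun z : D × D => u z.1 z.2) (hvm : Measurable fun z : D × D => v z.1 z.2)
    (hu : MemLp (fun z : D × D => u z.1 z.2) 2 (ν ⊗ₘ κ Δ))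
    (hv : MemLp (fun z : D × D => v z.1 z.2) 2 (ν ⊗ₘ κ Δ))
    (hmart : ∀ x, ∫ y, v x y ∂(κ Δ x) = 0) {i j : ℕ} (hij : i < j) :
    ∫ ω, u (Y ((i : ℝ≥0) * Δ) ω) (Y (((i + 1 : ℕ) : ℝ≥0) * Δ) ω) *
      v (Y ((j : ℝ≥0) * Δ) ω) (Y (((j + 1 : ℕ) : ℝ≥0) * Δ) ω) ∂Pr = 0 := by
  -- `W` is known at time $j\Delta$ because $i+1\le j$. Given `W`, only the last argument of `v` is
  -- random, and its conditional integral vanishes.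
  let W : Ω → (D × D) × D := fun ω =>
    ((Y ((i : ℝ≥0) * Δ) ω, Y (((i + 1 : ℕ) : ℝ≥0) * Δ) ω), Y ((j : ℝ≥0) * Δ) ω)
  have hle : ∀ l : ℕ, l ≤ j → (l : ℝ≥0) * Δ ≤ (j : ℝ≥0) * Δ := fun l hl => by gcongr
  have hW : Measurable[⨆ u : Set.Iic ((j : ℝ≥0) * Δ),
      MeasurableSpace.comap (Y u) inferInstance] W :=
    @Measurable.prodMk _ _ _ _ _ (_) _ _
      (@Measurable.prodMk _ _ _ _ _ (_) _ _ (measurable_past Y (hle i hij.le))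
        (measurable_past Y (hle (i + 1) hij))) (measurable_past Y (hle j le_rfl))
  have hWm : Measurable W := hW.mono (hY.past_le _) le_rfl
  have hmap := hY.map_prodMk Δ hW (measurable_snd) fun ω => rfl
  have hjΔ : (j : ℝ≥0) * Δ + Δ = ((j + 1 : ℕ) : ℝ≥0) * Δ := by push_cast; ring
  rw [hjΔ] at hmap
  let f : ((D × D) × D) × D → ℝ := fun q => u q.1.1.1 q.1.1.2 * v q.1.2 q.2
  have hf : Measurable f := by
    refine Measurable.mul ?_ ?_
    · exact hum.comp (measurable_fst.comp measurable_fst)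
    · exact hvm.comp ((measurable_snd.comp measurable_fst).prodMk measurable_snd)
  have hint : Integrable f (Pr.map fun ω => (W ω, Y (((j + 1 : ℕ) : ℝ≥0) * Δ) ω)) := by
    rw [integrable_map_measure hf.aestronglyMeasurable
      (hWm.prodMk (hY.measurable _)).aemeasurable]
    exact MemLp.integrable_mul (hu.comp_measurePreserving (hY.measurePreserving_pair hν i))
      (hv.comp_measurePreserving (hY.measurePreserving_pair hν j))
  have heq : ∫ ω, f (W ω, Y (((j + 1 : ℕ) : ℝ≥0) * Δ) ω) ∂Pr = 0 := by
    have : IsProbabilityMeasure (Pr.map W) := Measure.isProbabilityMeasure_map hWm.aemeasurable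
    rw [← integral_map (f := f) (hWm.prodMk (hY.measurable _)).aemeasurable
      hf.aestronglyMeasurable, hmap, Measure.integral_compProd (hmap ▸ hint)]
    simp only [f, Kernel.comap_apply, integral_const_mul, hmart, mul_zero, integral_zero]
  exact heq

/-- First and second moments of a sum of stationary martingale differences. -/
lemma IsMarkovProcess.integral_pathSum_sq (hY : IsMarkovProcess Pr Y κ ν)
    [∀ t, IsMarkovKernel (κ t)] (hν : ∀ t, Kernel.Invariant (κ t) ν) {u : D → D → ℝ}
    (hum : Measurable fun z : D × D => u z.1 z.2)
    (hu : MemLp (fun z : D × D => u z.1 z.2) 2 (ν ⊗ₘ κ Δ))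
    (hmart : ∀ x, ∫ y, u x y ∂(κ Δ x) = 0) (m : ℕ) :
    ∫ ω, (pathSum u (skeleton Y Δ m ω)) ^ 2 ∂Pr
      = m * ∫ z, (u z.1 z.2) ^ 2 ∂(ν ⊗ₘ κ Δ) := by
  simp only [pathSum_skeleton]
  let a : ℕ → Ω → ℝ := fun j ω => u (Y ((j : ℝ≥0) * Δ) ω) (Y (((j + 1 : ℕ) : ℝ≥0) * Δ) ω)
  have ha : ∀ j, MemLp (a j) 2 Pr := fun j =>
    hu.comp_measurePreserving (hY.measurePreserving_pair hν j)
  have hdiag : ∀ j, ∫ ω, a j ω * a j ω ∂Pr = ∫ z, (u z.1 z.2) ^ 2 ∂(ν ⊗ₘ κ Δ) := by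
    intro j
    rw [← (hY.measurePreserving_pair (Δ := Δ) hν j).map_eq,
      integral_map (hY.measurePreserving_pair hν j).measurable.aemeasurable
        (hum.pow_const 2).aestronglyMeasurable]
    simp only [a, sq]
  have hoff : ∀ i j, i ≠ j → ∫ ω, a i ω * a j ω ∂Pr = 0 := by
    intro i j hij
    rcases lt_or_gt_of_ne hij with h' | h'
    · exact hY.integral_mul_eq_zero hν hum hum hu hu hmart h'
    · simp only [mul_comm (a i _)]
      exact hY.integral_mul_eq_zero hν hum hum hu hu hmart h'
  change ∫ ω, (∑ j ∈ Finset.range m, a j ω) ^ 2 ∂Pr = _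
  simp only [sq, Finset.sum_mul_sum]
  have hint : ∀ i j, Integrable (fun ω => a i ω * a j ω) Pr := fun i j =>
    (ha i).integrable_mul (ha j)
  rw [integral_finsetSum _ fun i _ => integrable_finsetSum _ fun j _ => hint i j]
  simp_rw [integral_finsetSum _ fun j _ => hint _ j]
  rw [Finset.sum_congr rfl fun i hi => Finset.sum_eq_single_of_mem i hi
    fun j _ hj => hoff i j hj.symm]
  simp [hdiag, sq]

end Markov

/-! ### Limit theorems for i.i.d. observations -/

section IID

variable {Ω 𝒳 : Type*} [MeasurableSpace Ω] [MeasurableSpace 𝒳] {Pr : Measure Ω}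
  [IsProbabilityMeasure Pr] {ν : Measure 𝒳} {X : ℕ → Ω → 𝒳}

/-- Strong law of large numbers for a function of i.i.d. observations. -/
lemma ae_tendsto_average {F : Type*} [NormedAddCommGroup F] [NormedSpace ℝ F] [CompleteSpace F]
    [MeasurableSpace F] [BorelSpace F] (hX : ∀ i, MeasurePreserving (X i) Pr ν)
    (hind : iIndepFun X Pr) {g : 𝒳 → F} (hgm : Measurable g) (hg : Integrable g ν) :
    ∀ᵐ ω ∂Pr, Tendsto (fun n : ℕ => (n : ℝ)⁻¹ • ∑ i ∈ Finset.range n, g (X i ω)) atTop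
      (𝓝 (∫ x, g x ∂ν)) := by
  have h1 := strong_law_ae (μ := Pr) (fun i ω => g (X i ω))
    ((hX 0).integrable_comp_of_integrable hg)
    (fun i j hij => (hind.indepFun hij).comp hgm hgm)
    (fun i => (IdentDistrib.mk (hX i).measurable.aemeasurable (hX 0).measurable.aemeasurable
      (by rw [(hX i).map_eq, (hX 0).map_eq])).comp hgm)
  have h2 : ∫ ω, g (X 0 ω) ∂Pr = ∫ x, g x ∂ν := by
    rw [← (hX 0).map_eq, integral_map (hX 0).measurable.aemeasurable
      ((hX 0).map_eq ▸ hg.aestronglyMeasurable)]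
  rwa [h2] at h1

/-- Multivariate central limit theorem for centred square integrable functions of i.i.d.
observations. -/
lemma tendstoInDistribution_multivariateGaussian {p : ℕ}
    (hX : ∀ i, MeasurePreserving (X i) Pr ν) (hind : iIndepFun X Pr)
    {g : 𝒳 → EuclideanSpace ℝ (Fin p)} (hgm : Measurable g) (hg : MemLp g 2 ν)
    (hg0 : ∫ x, g x ∂ν = 0) {S : Matrix (Fin p) (Fin p) ℝ} (hS : S.IsHermitian)
    (hgS : ∀ t : EuclideanSpace ℝ (Fin p),
      ∫ x, (inner ℝ (g x) t) ^ 2 ∂ν = t ⬝ᵥ S.mulVec t) :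
    TendstoInDistribution (fun (n : ℕ) ω => (√(n : ℝ))⁻¹ • ∑ i ∈ Finset.range n, g (X i ω)) atTop
      (id : EuclideanSpace ℝ (Fin p) → EuclideanSpace ℝ (Fin p)) (fun _ => Pr)
      (multivariateGaussian 0 S) := by
  have hν : IsProbabilityMeasure ν := (hX 0).map_eq ▸
    Measure.isProbabilityMeasure_map (hX 0).measurable.aemeasurable
  have hpos : S.PosSemidef := by
    refine Matrix.PosSemidef.of_dotProduct_mulVec_nonneg hS fun x => ?_
    have := hgS (WithLp.toLp 2 x)
    simp only [star_trivial]
    change 0 ≤ (WithLp.toLp 2 x) ⬝ᵥ S.mulVec (WithLp.toLp 2 x)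
    rw [← this]
    exact integral_nonneg fun _ => sq_nonneg _
  have hmeas : ∀ n : ℕ, Measurable fun ω => (√(n : ℝ))⁻¹ • ∑ i ∈ Finset.range n, g (X i ω) :=
    fun n => by
      have := fun i => (hX i).measurable
      fun_prop
  refine ⟨fun n => (hmeas n).aemeasurable, by fun_prop, ?_⟩
  refine ProbabilityMeasure.tendsto_iff_tendsto_charFun.2 fun t => ?_
  -- Cramér–Wold: the characteristic function of the vector sum at `t` is that of the scalar sum of
  -- `u` at 1.
  let u : 𝒳 → ℝ := fun x => inner ℝ (g x) t
  have hum : Measurable u := hgm.inner_const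
  have huX : ∀ i, IdentDistrib (fun ω => u (X i ω)) (fun ω => u (X 0 ω)) Pr Pr := fun i =>
    (IdentDistrib.mk (hX i).measurable.aemeasurable (hX 0).measurable.aemeasurable
      (by rw [(hX i).map_eq, (hX 0).map_eq])).comp hum
  have hu2 : MemLp u 2 ν := hg.inner_const t
  have hu0 : ∫ ω, u (X 0 ω) ∂Pr = 0 := by
    rw [← integral_map (hX 0).measurable.aemeasurable hum.aestronglyMeasurable, (hX 0).map_eq]
    have := integral_inner (𝕜 := ℝ) (hg.integrable one_le_two) t
    simp only [u, real_inner_comm t]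
    rw [this, hg0, inner_zero_right]
  have huvar : Var[fun ω => u (X 0 ω); Pr] = t ⬝ᵥ S.mulVec t := by
    rw [variance_of_integral_eq_zero (X := fun ω => u (X 0 ω))
      (hum.comp (hX 0).measurable).aemeasurable hu0, ← hgS t,
      ← (hX 0).map_eq, integral_map (hX 0).measurable.aemeasurable
        (hum.pow_const 2).aestronglyMeasurable]
  let v : ℝ≥0 := (Var[fun ω => u (X 0 ω); Pr]).toNNReal
  have hclt := tendstoInDistribution_inv_sqrt_mul_sum_sub (P := Pr) (P' := gaussianReal 0 v)
    (X := fun i ω => u (X i ω)) (Y := id) ⟨aemeasurable_id, Measure.map_id⟩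
    (hu2.comp_measurePreserving (hX 0)) (hind.comp (fun _ => u) fun _ => hum) huX
  have hchar := (ProbabilityMeasure.tendsto_iff_tendsto_charFun.1 hclt.tendsto) 1
  simp only [ProbabilityMeasure.coe_mk] at hchar ⊢
  rw [Measure.map_id, charFun_gaussianReal] at hchar
  rw [Measure.map_id, charFun_multivariateGaussian hpos]
  have hv : ((v : ℝ) : ℂ) = ((t ⬝ᵥ S.mulVec t : ℝ) : ℂ) := by
    rw [Real.coe_toNNReal _ (variance_nonneg _ _), huvar]
  convert hchar using 2 with n
  · rw [charFun_apply, charFun_apply, integral_map (hmeas n).aemeasurable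
      (by fun_prop), integral_map (hclt.forall_aemeasurable n) (by fun_prop)]
    refine integral_congr_ae (Eventually.of_forall fun ω => ?_)
    simp only [hu0, mul_zero, sub_zero, inner_smul_left, sum_inner, u]
    simp
  · rw [hv]
    simp

end IID

/-! ### Almost sure eventual properties and transfer of limit laws -/

section Eventually

variable {Ω : Type*} [MeasurableSpace Ω] {Pr : Measure Ω} [IsProbabilityMeasure Pr]

/-- The property `q n` holds, almost surely, for all large `n`, on measurable events. -/
def EventuallyAS (Pr : Measure Ω) (q : ℕ → Ω → Prop) : Prop :=
  ∃ U : ℕ → Set Ω, (∀ n, MeasurableSet (U n)) ∧ (∀ᵐ ω ∂Pr, ∀ᶠ n in atTop, ω ∈ U n) ∧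
    ∀ n, ∀ ω ∈ U n, q n ω

lemma EventuallyAS.ae {q : ℕ → Ω → Prop} (hq : EventuallyAS Pr q) :
    ∀ᵐ ω ∂Pr, ∀ᶠ n in atTop, q n ω := by
  obtain ⟨U, -, hU, hUq⟩ := hq
  filter_upwards [hU] with ω hω
  exact hω.mono fun n hn => hUq n ω hn

lemma EventuallyAS.mono {q q' : ℕ → Ω → Prop} (hq : EventuallyAS Pr q)
    (h : ∀ n ω, q n ω → q' n ω) : EventuallyAS Pr q' := by
  obtain ⟨U, hm, hU, hUq⟩ := hq
  exact ⟨U, hm, hU, fun n ω hω => h n ω (hUq n ω hω)⟩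

lemma EventuallyAS.and {q q' : ℕ → Ω → Prop} (hq : EventuallyAS Pr q)
    (hq' : EventuallyAS Pr q') : EventuallyAS Pr fun n ω => q n ω ∧ q' n ω := by
  obtain ⟨U, hm, hU, hUq⟩ := hq
  obtain ⟨U', hm', hU', hUq'⟩ := hq'
  refine ⟨fun n => U n ∩ U' n, fun n => (hm n).inter (hm' n), ?_,
    fun n ω hω => ⟨hUq n ω hω.1, hUq' n ω hω.2⟩⟩
  filter_upwards [hU, hU'] with ω h1 h2
  exact h1.and h2

lemma EventuallyAS.of_forall_ge {q : ℕ → Ω → Prop} (N : ℕ) (hq : ∀ n ≥ N, ∀ ω, q n ω) :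
    EventuallyAS Pr q := by
  refine ⟨fun n => {_ω | N ≤ n}, fun n => MeasurableSet.const _, ?_, fun n ω hn => hq n hn ω⟩
  exact Eventually.of_forall fun ω => eventually_ge_atTop N

lemma EventuallyAS.of_tendsto {F : Type*} [PseudoMetricSpace F] [MeasurableSpace F]
    [OpensMeasurableSpace F] {Z : ℕ → Ω → F} (hZ : ∀ n, Measurable (Z n)) {a : F}
    (hlim : ∀ᵐ ω ∂Pr, Tendsto (fun n => Z n ω) atTop (𝓝 a)) {ε : ℝ} (hε : 0 < ε) :
    EventuallyAS Pr fun n ω => dist (Z n ω) a < ε := by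
  refine ⟨fun n => Z n ⁻¹' Metric.ball a ε, fun n => hZ n Metric.isOpen_ball.measurableSet, ?_,
    fun n ω hω => hω⟩
  filter_upwards [hlim] with ω hω
  exact hω (Metric.ball_mem_nhds a hε)

/-- The events `q n` often quantify over uncountably many parameters and need not be measurable. The
measurable witnesses `U n` make the passage from almost sure to in probability legitimate. -/
lemma EventuallyAS.tendsto_measure {q : ℕ → Ω → Prop} (hq : EventuallyAS Pr q) :
    Tendsto (fun n => Pr {ω | ¬ q n ω}) atTop (𝓝 0) := by
  obtain ⟨U, hm, hU, hUq⟩ := hq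
  have h1 : Tendsto (fun n => Pr (U n)ᶜ) atTop (𝓝 (Pr ∅)) := by
    refine tendsto_measure_of_ae_tendsto_indicator_of_isFiniteMeasure atTop MeasurableSet.empty
      (fun n => (hm n).compl) ?_
    filter_upwards [hU] with ω hω
    filter_upwards [hω] with n hn
    simp [hn]
  rw [measure_empty] at h1
  exact tendsto_of_tendsto_of_tendsto_of_le_of_le tendsto_const_nhds h1 (fun n => zero_le)
    fun n => measure_mono fun ω hω hωU => hω (hUq n ω hωU)

/-- If `D n` is relatively close to `Z n` with probability tending to one and `Z n` converges in
law, then `D n` has the same limit law. -/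
lemma tendstoInDistribution_of_relatively_close {F : Type*} [NormedAddCommGroup F]
    [MeasurableSpace F] [BorelSpace F] [SecondCountableTopology F]
    {Z D : ℕ → Ω → F} {γ : Measure F} [IsProbabilityMeasure γ]
    (hZ : TendstoInDistribution Z atTop (id : F → F) (fun _ => Pr) γ)
    (hD : ∀ n, AEMeasurable (D n) Pr)
    (hclose : ∀ δ : ℝ, 0 < δ → Tendsto (fun n => Pr {ω | ¬ ‖D n ω - Z n ω‖ ≤ δ * ‖Z n ω‖}) atTop
      (𝓝 0)) :
    TendstoInDistribution D atTop (id : F → F) (fun _ => Pr) γ := by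
  refine tendstoInDistribution_of_tendstoInMeasure_sub D id hZ ?_ hD
  rw [tendstoInMeasure_iff_norm]
  intro η hη
  rw [ENNReal.tendsto_nhds_zero]
  intro ε hε
  have hε2 : 0 < ε / 2 := ENNReal.half_pos hε.ne'
  -- tightness of the limit law
  obtain ⟨a, ha0, ha⟩ : ∃ a : ℝ, 0 < a ∧ γ {z | a ≤ ‖z‖} < ε / 2 := by
    have h1 : Tendsto (fun k : ℕ => γ {z : F | (k : ℝ) ≤ ‖z‖}) atTop
        (𝓝 (γ (⋂ k : ℕ, {z : F | (k : ℝ) ≤ ‖z‖}))) := by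
      refine tendsto_measure_iInter_atTop
        (fun k => (measurableSet_le measurable_const measurable_norm).nullMeasurableSet) ?_
        ⟨0, measure_ne_top _ _⟩
      intro k l hkl z hz
      exact (Nat.cast_le.2 hkl).trans (show (l : ℝ) ≤ ‖z‖ from hz)
    have h2 : (⋂ k : ℕ, {z : F | (k : ℝ) ≤ ‖z‖}) = ∅ := by
      refine eq_empty_of_forall_notMem fun z hz => ?_
      obtain ⟨k, hk⟩ := exists_nat_gt ‖z‖
      exact (not_le.2 hk) (mem_iInter.1 hz k)
    rw [h2, measure_empty] at h1
    obtain ⟨k, hk, hk0⟩ := ((h1.eventually_lt_const hε2).and (eventually_gt_atTop 0)).exists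
    exact ⟨k, Nat.cast_pos.2 hk0, hk⟩
  -- The portmanteau theorem for a closed tail set carries the tightness of the limit over to `Z n`.
  have hlimsup : limsup (fun n => Pr {ω | a ≤ ‖Z n ω‖}) atTop ≤ γ {z | a ≤ ‖z‖} := by
    have hcl : IsClosed {z : F | a ≤ ‖z‖} := isClosed_le continuous_const continuous_norm
    have := ProbabilityMeasure.limsup_measure_closed_le_of_tendsto hZ.tendsto hcl
    simp only [ProbabilityMeasure.coe_mk, Measure.map_id] at this
    refine le_trans (le_of_eq ?_) this
    refine limsup_congr (Eventually.of_forall fun n => ?_)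
    rw [Measure.map_apply_of_aemeasurable (hZ.forall_aemeasurable n) hcl.measurableSet]
    rfl
  have hlt := eventually_lt_of_limsup_lt (hlimsup.trans_lt ha)
  -- With this relative accuracy, $\|Z_n\|<a$ forces $\|D_n-Z_n\|\le\eta/2<\eta$.
  have hδ : 0 < η / (2 * a) := by positivity
  have hcl := ENNReal.tendsto_nhds_zero.1 (hclose _ hδ) (ε / 2) hε2
  filter_upwards [hlt, hcl] with n h1 h2
  calc Pr {ω | η ≤ ‖(D - Z) n ω - (0 : ℕ → Ω → F) n ω‖}
      ≤ Pr ({ω | a ≤ ‖Z n ω‖} ∪ {ω | ¬ ‖D n ω - Z n ω‖ ≤ η / (2 * a) * ‖Z n ω‖}) := by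
        refine measure_mono fun ω hω => ?_
        by_contra hcon
        simp only [mem_union, mem_ofPred_eq, not_or, not_le, not_lt] at hcon
        have hω' : η ≤ ‖D n ω - Z n ω‖ := by simpa using hω
        have h3 : η / (2 * a) * ‖Z n ω‖ ≤ η / (2 * a) * a :=
          mul_le_mul_of_nonneg_left hcon.1.le hδ.le
        have h4 : η / (2 * a) * a = η / 2 := by field_simp
        linarith [hcon.2]
    _ ≤ ε / 2 + ε / 2 := (measure_union_le _ _).trans (add_le_add h1.le h2)
    _ = ε := ENNReal.add_halves ε

end Eventually

/-! ### Local uniform linearization of averages -/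

section Local

lemma eventuallyAS_dist_average_lt {Ω 𝒳 F : Type*} [MeasurableSpace Ω] [MeasurableSpace 𝒳]
    {Pr : Measure Ω} [IsProbabilityMeasure Pr] {ν : Measure 𝒳} {X : ℕ → Ω → 𝒳}
    [NormedAddCommGroup F] [NormedSpace ℝ F] [CompleteSpace F]
    [SecondCountableTopology F] [MeasurableSpace F] [BorelSpace F]
    (hX : ∀ i, MeasurePreserving (X i) Pr ν)
    (hind : iIndepFun X Pr) {g : 𝒳 → F} (hgm : Measurable g) (hg : Integrable g ν) {ε : ℝ}
    (hε : 0 < ε) :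
    EventuallyAS Pr fun n ω =>
      dist ((n : ℝ)⁻¹ • ∑ i ∈ Finset.range n, g (X i ω)) (∫ x, g x ∂ν) < ε :=
  EventuallyAS.of_tendsto (fun _ => Measurable.fun_const_smul
    (Finset.measurable_sum _ fun i _ => hgm.comp (hX i).measurable) _)
    (ae_tendsto_average hX hind hgm hg) hε

variable {Ω 𝒳 : Type*} [MeasurableSpace Ω] [MeasurableSpace 𝒳] {Pr : Measure Ω}
  [IsProbabilityMeasure Pr] {ν : Measure 𝒳} {X : ℕ → Ω → 𝒳}
  {E : Type*} [NormedAddCommGroup E] [NormedSpace ℝ E] [MeasurableSpace E]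

/-- The average `n⁻¹ ∑ f(X_i, θ)`. -/
def average (f : 𝒳 → E → E) (X : ℕ → Ω → 𝒳) (n : ℕ) (θ : E) (ω : Ω) : E :=
  (n : ℝ)⁻¹ • ∑ i ∈ Finset.range n, f (X i ω) θ

/-- Hypotheses under which averages of `f` are smooth around `θ₀`, locally uniformly. -/
structure LocallyDominated (ν : Measure 𝒳) (f : 𝒳 → E → E) (f' : 𝒳 → E → E →L[ℝ] E) (θ₀ : E)
    (r₀ : ℝ) (H : 𝒳 → ℝ) : Prop where
  pos : 0 < r₀
  measurable : ∀ θ ∈ Metric.ball θ₀ r₀, Measurable fun x => f x θ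
  hasFDerivAt : ∀ x, ∀ θ ∈ Metric.ball θ₀ r₀, HasFDerivAt (f x) (f' x θ) θ
  continuousAt : ∀ x, ContinuousAt (f' x) θ₀
  bound : ∀ x, ∀ θ ∈ Metric.ball θ₀ r₀, ‖f' x θ‖ ≤ H x
  integrable : Integrable H ν

variable {f : 𝒳 → E → E} {f' : 𝒳 → E → E →L[ℝ] E} {θ₀ : E} {r₀ : ℝ} {H : 𝒳 → ℝ}

/-- Linearization error quotient. -/
def linErr (f : 𝒳 → E → E) (f' : 𝒳 → E → E →L[ℝ] E) (θ₀ : E) (x : 𝒳) (a b : E) : ℝ :=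
  ‖f x a - f x b - f' x θ₀ (a - b)‖ / ‖a - b‖

open Classical in
/-- The largest linearization error on the ball of radius `r` (over a countable dense set). -/
def modulus [SecondCountableTopology E] (f : 𝒳 → E → E) (f' : 𝒳 → E → E →L[ℝ] E) (θ₀ : E)
    (r : ℝ) (x : 𝒳) : ℝ :=
  ⨆ q : ℕ × ℕ, if TopologicalSpace.denseSeq E q.1 ∈ Metric.ball θ₀ r ∧
      TopologicalSpace.denseSeq E q.2 ∈ Metric.ball θ₀ r then
    linErr f f' θ₀ x (TopologicalSpace.denseSeq E q.1) (TopologicalSpace.denseSeq E q.2) else 0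

/-- The mean value inequality on the convex ball, relative to the fixed linear map `f' x θ₀`. -/
lemma linErr_le (hf : LocallyDominated ν f f' θ₀ r₀ H) {r C : ℝ} (hr : r ≤ r₀) (hC : 0 ≤ C)
    {x : 𝒳} (hb : ∀ θ ∈ Metric.ball θ₀ r, ‖f' x θ - f' x θ₀‖ ≤ C) {a b : E}
    (ha : a ∈ Metric.ball θ₀ r) (hb' : b ∈ Metric.ball θ₀ r) : linErr f f' θ₀ x a b ≤ C := by
  refine div_le_of_le_mul₀ (norm_nonneg _) hC ?_
  exact (convex_ball θ₀ r).norm_image_sub_le_of_norm_hasFDerivWithin_le'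
    (fun θ hθ => (hf.hasFDerivAt x θ (Metric.ball_subset_ball hr hθ)).hasFDerivWithinAt) hb hb' ha

variable [SecondCountableTopology E]

lemma modulus_le (hf : LocallyDominated ν f f' θ₀ r₀ H) {r C : ℝ} (hr : r ≤ r₀) (hC : 0 ≤ C)
    {x : 𝒳} (hb : ∀ θ ∈ Metric.ball θ₀ r, ‖f' x θ - f' x θ₀‖ ≤ C) : modulus f f' θ₀ r x ≤ C := by
  refine ciSup_le fun q => ?_
  split_ifs with h
  exacts [linErr_le hf hr hC hb h.1 h.2, hC]

lemma LocallyDominated.norm_deriv_sub_le (hf : LocallyDominated ν f f' θ₀ r₀ H) {r : ℝ} (hr : r ≤ r₀)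
    (x : 𝒳) : ∀ θ ∈ Metric.ball θ₀ r, ‖f' x θ - f' x θ₀‖ ≤ 2 * H x := fun θ hθ =>
  (norm_sub_le _ _).trans (by
    linarith [hf.bound x θ (Metric.ball_subset_ball hr hθ),
      hf.bound x θ₀ (Metric.mem_ball_self hf.pos)])

lemma LocallyDominated.bound_nonneg (hf : LocallyDominated ν f f' θ₀ r₀ H) (x : 𝒳) : 0 ≤ H x :=
  (norm_nonneg _).trans (hf.bound x θ₀ (Metric.mem_ball_self hf.pos))

lemma modulus_bddAbove (hf : LocallyDominated ν f f' θ₀ r₀ H) {r : ℝ} (hr : r ≤ r₀) (x : 𝒳) :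
    BddAbove (range fun q : ℕ × ℕ => open Classical in
      if TopologicalSpace.denseSeq E q.1 ∈ Metric.ball θ₀ r ∧
        TopologicalSpace.denseSeq E q.2 ∈ Metric.ball θ₀ r then
      linErr f f' θ₀ x (TopologicalSpace.denseSeq E q.1) (TopologicalSpace.denseSeq E q.2)
      else 0) := by
  have h0 := hf.bound_nonneg x
  refine ⟨2 * H x, ?_⟩
  rintro _ ⟨q, rfl⟩
  dsimp only
  split_ifs with h
  · exact linErr_le hf hr (by positivity) (hf.norm_deriv_sub_le hr x) h.1 h.2
  · positivity

lemma modulus_nonneg (r : ℝ) (x : 𝒳) : 0 ≤ modulus f f' θ₀ r x := by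
  refine Real.iSup_nonneg fun q => ?_
  split_ifs
  · exact div_nonneg (norm_nonneg _) (norm_nonneg _)
  · exact le_rfl

/-- A supremum over a countable dense set is measurable in `x`; continuity of `f x` extends the
resulting bound to all pairs in the ball. Measurability of `f'` away from `θ₀` is never needed. -/
lemma norm_sub_sub_le_modulus (hf : LocallyDominated ν f f' θ₀ r₀ H) {r : ℝ} (hr : r ≤ r₀)
    (x : 𝒳) {a b : E} (ha : a ∈ Metric.ball θ₀ r) (hb : b ∈ Metric.ball θ₀ r) :
    ‖f x a - f x b - f' x θ₀ (a - b)‖ ≤ modulus f f' θ₀ r x * ‖a - b‖ := by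
  let d := TopologicalSpace.denseSeq E
  have hd : Dense (range fun q : ℕ × ℕ => (d q.1, d q.2)) := by
    have := (TopologicalSpace.denseRange_denseSeq E).prodMap
      (TopologicalSpace.denseRange_denseSeq E)
    exact this
  let O : Set (E × E) := Metric.ball θ₀ r ×ˢ Metric.ball θ₀ r
  have hO : IsOpen O := Metric.isOpen_ball.prod Metric.isOpen_ball
  have hcl : (a, b) ∈ closure (O ∩ range fun q : ℕ × ℕ => (d q.1, d q.2)) :=
    hd.open_subset_closure_inter hO ⟨ha, hb⟩
  have hfc : ContinuousOn (f x) (Metric.ball θ₀ r) := fun θ hθ =>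
    (hf.hasFDerivAt x θ (Metric.ball_subset_ball hr hθ)).continuousAt.continuousWithinAt
  have hc1 : ContinuousOn (fun q : E × E => ‖f x q.1 - f x q.2 - f' x θ₀ (q.1 - q.2)‖) O := by
    have h1 : ContinuousOn (fun q : E × E => f x q.1) O :=
      hfc.comp continuousOn_fst fun q hq => hq.1
    have h2 : ContinuousOn (fun q : E × E => f x q.2) O :=
      hfc.comp continuousOn_snd fun q hq => hq.2
    have h3 : Continuous fun q : E × E => f' x θ₀ (q.1 - q.2) := by fun_prop
    exact ((h1.sub h2).sub h3.continuousOn).norm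
  have hc2 : Continuous fun q : E × E => modulus f f' θ₀ r x * ‖q.1 - q.2‖ := by fun_prop
  have hmem := mem_closure_iff_seq_limit.1 hcl
  obtain ⟨s, hs, hlim⟩ := hmem
  have hlimO : Tendsto s atTop (𝓝[O] (a, b)) :=
    tendsto_nhdsWithin_iff.2 ⟨hlim, Eventually.of_forall fun n => (hs n).1⟩
  refine le_of_tendsto_of_tendsto ((hc1 (a, b) ⟨ha, hb⟩).tendsto.comp hlimO)
    ((hc2.tendsto (a, b)).comp hlim) (Eventually.of_forall fun n => ?_)
  obtain ⟨hO', q, hq⟩ := hs n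
  have hle := le_ciSup (modulus_bddAbove hf hr x) q
  have hcond : d q.1 ∈ Metric.ball θ₀ r ∧ d q.2 ∈ Metric.ball θ₀ r := by
    rw [← hq] at hO'; exact hO'
  rw [if_pos hcond] at hle
  change ‖f x (s n).1 - f x (s n).2 - f' x θ₀ ((s n).1 - (s n).2)‖ ≤
    modulus f f' θ₀ r x * ‖(s n).1 - (s n).2‖
  rw [← hq]
  rcases eq_or_ne (d q.1) (d q.2) with heq | hne
  · simp [heq]
  · rw [← div_le_iff₀ (norm_pos_iff.2 (sub_ne_zero.2 hne))]
    exact hle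

lemma measurable_modulus [BorelSpace E] [FiniteDimensional ℝ E]
    (hf : LocallyDominated ν f f' θ₀ r₀ H)
    (hA : Measurable fun x => f' x θ₀) {r : ℝ} (hr : r ≤ r₀) : Measurable (modulus f f' θ₀ r) := by
  refine Measurable.iSup fun q => ?_
  split_ifs with h
  · refine Measurable.div_const (Measurable.norm (Measurable.sub (Measurable.sub
      (hf.measurable _ (Metric.ball_subset_ball hr h.1))
      (hf.measurable _ (Metric.ball_subset_ball hr h.2))) ?_)) _
    exact hA.apply_continuousLinearMap _
  · exact measurable_const

lemma integrable_modulus [BorelSpace E] [FiniteDimensional ℝ E]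
    (hf : LocallyDominated ν f f' θ₀ r₀ H)
    (hA : Measurable fun x => f' x θ₀) {r : ℝ} (hr : r ≤ r₀) :
    Integrable (modulus f f' θ₀ r) ν := by
  refine (hf.integrable.const_mul 2).mono' (measurable_modulus hf hA hr).aestronglyMeasurable
    (Eventually.of_forall fun x => ?_)
  rw [Real.norm_eq_abs, abs_of_nonneg (modulus_nonneg r x)]
  exact modulus_le hf hr (by linarith [hf.bound_nonneg x]) (hf.norm_deriv_sub_le hr x)

/-- Continuity of `f' x` at `θ₀` sends the modulus to zero pointwise, and $2H$ dominates it on every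
ball of radius at most `r₀`. -/
lemma tendsto_integral_modulus [BorelSpace E] [FiniteDimensional ℝ E]
    (hf : LocallyDominated ν f f' θ₀ r₀ H) (hA : Measurable fun x => f' x θ₀) :
    Tendsto (fun k : ℕ => ∫ x, modulus f f' θ₀ (min r₀ (1 / ((k : ℝ) + 1))) x ∂ν) atTop (𝓝 0) := by
  rw [← integral_zero 𝒳 ℝ (μ := ν)]
  refine tendsto_integral_of_dominated_convergence (fun x => 2 * H x)
    (fun k => (measurable_modulus hf hA (min_le_left _ _)).aestronglyMeasurable)
    (hf.integrable.const_mul 2) (fun k => Eventually.of_forall fun x => ?_)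
    (Eventually.of_forall fun x => ?_)
  · rw [Real.norm_eq_abs, abs_of_nonneg (modulus_nonneg _ x)]
    exact modulus_le hf (min_le_left _ _) (by linarith [hf.bound_nonneg x])
      (hf.norm_deriv_sub_le (min_le_left _ _) x)
  · rw [Metric.tendsto_atTop]
    intro ε hε
    obtain ⟨δ, hδ, hball⟩ := Metric.continuousAt_iff.1 (hf.continuousAt x) (ε / 2) (by positivity)
    obtain ⟨N, hN⟩ := exists_nat_one_div_lt hδ
    refine ⟨N, fun k hk => ?_⟩
    rw [Real.dist_eq, sub_zero, abs_of_nonneg (modulus_nonneg _ x)]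
    refine (modulus_le hf (C := ε / 2) (min_le_left _ _) (by positivity) fun θ hθ => ?_).trans_lt
      (by linarith)
    rw [← dist_eq_norm]
    refine (hball ?_).le
    have h1 : dist θ θ₀ < 1 / ((k : ℝ) + 1) := (Metric.mem_ball.1 hθ).trans_le (min_le_right _ _)
    exact h1.trans_le ((Nat.one_div_le_one_div hk).trans hN.le)

lemma norm_average_sub_sub_le (hf : LocallyDominated ν f f' θ₀ r₀ H) {r : ℝ} (hr : r ≤ r₀)
    (n : ℕ) (ω : Ω) {a b : E} (ha : a ∈ Metric.ball θ₀ r) (hb : b ∈ Metric.ball θ₀ r) :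
    ‖average f X n a ω - average f X n b ω -
      ((n : ℝ)⁻¹ • ∑ i ∈ Finset.range n, f' (X i ω) θ₀) (a - b)‖
      ≤ ((n : ℝ)⁻¹ • ∑ i ∈ Finset.range n, modulus f f' θ₀ r (X i ω)) * ‖a - b‖ := by
  have heq : average f X n a ω - average f X n b ω -
      ((n : ℝ)⁻¹ • ∑ i ∈ Finset.range n, f' (X i ω) θ₀) (a - b) = (n : ℝ)⁻¹ •
      ∑ i ∈ Finset.range n, (f (X i ω) a - f (X i ω) b - f' (X i ω) θ₀ (a - b)) := by
    simp only [average, smul_apply, sum_apply,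
      ← smul_sub, ← Finset.sum_sub_distrib]
  rw [heq, norm_smul, norm_inv, Real.norm_natCast, smul_eq_mul, mul_assoc, Finset.sum_mul]
  gcongr
  exact norm_sum_le_of_le _ fun i _ => norm_sub_sub_le_modulus hf hr _ ha hb

/-- Almost surely, averages of `f` are eventually nearly linear close to `θ₀`. -/
lemma eventuallyAS_approximatesLinearOn [BorelSpace E] [FiniteDimensional ℝ E]
    (hX : ∀ i, MeasurePreserving (X i) Pr ν) (hind : iIndepFun X Pr)
    (hf : LocallyDominated ν f f' θ₀ r₀ H) (hA : Measurable fun x => f' x θ₀) {c : ℝ≥0}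
    (hc : 0 < c) :
    ∃ r, 0 < r ∧ r ≤ r₀ ∧ EventuallyAS Pr fun n ω =>
      ApproximatesLinearOn (fun θ => average f X n θ ω) (∫ x, f' x θ₀ ∂ν)
        (Metric.ball θ₀ r) c := by
  have : CompleteSpace E := FiniteDimensional.complete ℝ E
  have hAint : Integrable (fun x => f' x θ₀) ν :=
    hf.integrable.mono' hA.aestronglyMeasurable
      (Eventually.of_forall fun x => hf.bound x θ₀ (Metric.mem_ball_self hf.pos))
  -- One third each for the mean modulus, for the fluctuation of its average, and for the deviation
  -- of the averaged derivative from its mean.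
  have hc2 : (0 : ℝ) < c / 3 := by positivity
  obtain ⟨k, hk⟩ := ((tendsto_integral_modulus hf hA).eventually_lt_const hc2).exists
  set r := min r₀ (1 / ((k : ℝ) + 1)) with hrdef
  have hr : r ≤ r₀ := min_le_left _ _
  refine ⟨r, lt_min hf.pos (by positivity), hr, ?_⟩
  have hW := eventuallyAS_dist_average_lt hX hind (measurable_modulus hf hA hr)
    (integrable_modulus hf hA hr) hc2
  have hAn := eventuallyAS_dist_average_lt hX hind hA hAint hc2
  refine (hW.and hAn).mono fun n ω ⟨h1, h2⟩ a ha b hb => ?_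
  have hsum := norm_average_sub_sub_le (X := X) hf hr n ω ha hb
  rw [Real.dist_eq] at h1
  rw [dist_eq_norm] at h2
  have h1' := (abs_lt.1 h1).2
  generalize ∫ x, f' x θ₀ ∂ν = A at *
  generalize (n : ℝ)⁻¹ • ∑ i ∈ Finset.range n, modulus f f' θ₀ r (X i ω) = W at *
  generalize (n : ℝ)⁻¹ • ∑ i ∈ Finset.range n, f' (X i ω) θ₀ = An at *
  have hsplit : average f X n a ω - average f X n b ω - A (a - b) =
      (average f X n a ω - average f X n b ω - An (a - b)) + (An - A) (a - b) := by
    simp only [sub_apply]; abel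
  rw [hsplit]
  calc _ ≤ W * ‖a - b‖ + ‖An - A‖ * ‖a - b‖ :=
        (norm_add_le _ _).trans (add_le_add hsum ((An - A).le_opNorm _))
    _ = (W + ‖An - A‖) * ‖a - b‖ := by ring
    _ ≤ c * ‖a - b‖ := by
        gcongr
        linarith

end Local

/-! ### Deterministic analysis of roots of nearly linear maps -/

section Roots

variable {E : Type*} [NormedAddCommGroup E] [NormedSpace ℝ E] {G : E → E} {A A' : E →L[ℝ] E}
  {θ₀ : E} {r K : ℝ} {c : ℝ≥0}

lemma norm_le_of_leftInverse (hA : ∀ v, A' (A v) = v) (hK : ‖A'‖ ≤ K) (v : E) :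
    ‖v‖ ≤ K * ‖A v‖ := by
  calc ‖v‖ = ‖A' (A v)‖ := by rw [hA]
    _ ≤ ‖A'‖ * ‖A v‖ := A'.le_opNorm _
    _ ≤ K * ‖A v‖ := by gcongr

/-- A quantitative open mapping argument: the image of the ball of radius `ε` covers the ball of
radius $(K^{-1}-c)\varepsilon\ge\varepsilon/(2K)$ about `G θ₀`, and the latter contains 0. -/
lemma ApproximatesLinearOn.exists_root [CompleteSpace E]
    (hG : ApproximatesLinearOn G A (Metric.ball θ₀ r) c) (hA : ∀ v, A (A' v) = v)
    (hK : ‖A'‖ ≤ K) (hK0 : 0 < K) (hc : (c : ℝ) ≤ 1 / (2 * K)) {ε : ℝ} (hε0 : 0 ≤ ε) (hε : ε < r)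
    (h0 : ‖G θ₀‖ ≤ ε / (2 * K)) : ∃ θ ∈ Metric.closedBall θ₀ ε, G θ = 0 := by
  let R : A.NonlinearRightInverse :=
    { toFun := A', nnnorm := ⟨K, hK0.le⟩, bound' := fun y => A'.le_of_opNorm_le hK y,
      right_inv' := hA }
  have hsurj := hG.surjOn_closedBall_of_nonlinearRightInverse R hε0
    (Metric.closedBall_subset_ball hε)
  have hmem : (0 : E) ∈ Metric.closedBall (G θ₀) (((R.nnnorm : ℝ)⁻¹ - c) * ε) := by
    rw [Metric.mem_closedBall, dist_eq_norm, zero_sub, norm_neg]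
    refine h0.trans ?_
    have h1 : 1 / (2 * K) ≤ K⁻¹ - c := by
      have : K⁻¹ = 1 / (2 * K) + 1 / (2 * K) := by field_simp; norm_num
      linarith
    calc ε / (2 * K) = 1 / (2 * K) * ε := by ring
      _ ≤ (K⁻¹ - c) * ε := by gcongr
  obtain ⟨θ, hθ, hθ0⟩ := hsurj hmem
  exact ⟨θ, hθ, hθ0⟩

/-- For two roots $\|A(a-b)\|\le c\|a-b\|$, whence $\|a-b\|\le Kc\|a-b\|\le\tfrac12\|a-b\|$. -/
lemma ApproximatesLinearOn.root_unique
    (hG : ApproximatesLinearOn G A (Metric.ball θ₀ r) c) (hA : ∀ v, A' (A v) = v)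
    (hK : ‖A'‖ ≤ K) (hK0 : 0 < K) (hc : (c : ℝ) ≤ 1 / (2 * K)) {a b : E}
    (ha : a ∈ Metric.ball θ₀ r) (hb : b ∈ Metric.ball θ₀ r) (ha0 : G a = 0) (hb0 : G b = 0) :
    a = b := by
  have h1 := hG a ha b hb
  rw [ha0, hb0, sub_zero, zero_sub, norm_neg] at h1
  have h2 := norm_le_of_leftInverse hA hK (a - b)
  have h3 : K * ‖A (a - b)‖ ≤ K * (1 / (2 * K) * ‖a - b‖) := by
    gcongr
    exact h1.trans (by gcongr)
  have h4 : K * (1 / (2 * K) * ‖a - b‖) = ‖a - b‖ / 2 := by field_simp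
  have : ‖a - b‖ ≤ 0 := by linarith
  exact sub_eq_zero.1 (norm_le_zero_iff.1 this)

/-- A root close to `θ₀` is close to the Newton step from `θ₀`. -/
lemma ApproximatesLinearOn.norm_root_sub_le
    (hG : ApproximatesLinearOn G A (Metric.ball θ₀ r) c) (hA : ∀ v, A' (A v) = v)
    (hK : ‖A'‖ ≤ K) (hK0 : 0 < K) (hc : (c : ℝ) ≤ 1 / (2 * K)) {θ : E}
    (hθ : θ ∈ Metric.ball θ₀ r) (hθ0 : G θ = 0) :
    ‖(θ - θ₀) - -A' (G θ₀)‖ ≤ 2 * K * c * ‖A' (G θ₀)‖ := by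
  have hr : 0 < r := dist_nonneg.trans_lt hθ
  have h1 := hG θ hθ θ₀ (Metric.mem_ball_self hr)
  have h2 : (θ - θ₀) - -A' (G θ₀) = A' (-(G θ - G θ₀ - A (θ - θ₀))) := by
    rw [hθ0, zero_sub, neg_sub, sub_neg_eq_add, sub_neg_eq_add, map_add, hA]
  have h3 : ‖(θ - θ₀) - -A' (G θ₀)‖ ≤ K * (c * ‖θ - θ₀‖) := by
    rw [h2]
    refine (A'.le_of_opNorm_le hK _).trans ?_
    rw [norm_neg]
    gcongr
  have h4 : ‖θ - θ₀‖ ≤ ‖(θ - θ₀) - -A' (G θ₀)‖ + ‖A' (G θ₀)‖ := by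
    have := norm_add_le ((θ - θ₀) - -A' (G θ₀)) (-A' (G θ₀))
    rwa [sub_add_cancel, norm_neg] at this
  have h5 : K * (c : ℝ) ≤ 1 / 2 := by
    calc K * (c : ℝ) ≤ K * (1 / (2 * K)) := by gcongr
      _ = 1 / 2 := by field_simp
  have h6 : 0 ≤ K * (c : ℝ) := by positivity
  set u := ‖(θ - θ₀) - -A' (G θ₀)‖
  set w := ‖A' (G θ₀)‖
  -- Since $Kc\le 1/2$, the term in `u` on the right is absorbed at the cost of a factor 2.
  have h7 : u ≤ K * c * (u + w) := h3.trans (by rw [← mul_assoc]; gcongr)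
  nlinarith [norm_nonneg ((θ - θ₀) - -A' (G θ₀))]

end Roots

/-! ### Measurability and elementary properties of estimators -/

section Estimators

variable {Ω : Type*} {p : ℕ} {Θ : Set (EuclideanSpace ℝ (Fin p))} {𝒢 mΩ : MeasurableSpace Ω}
  {Pr : Measure Ω}

lemma IsMeasurableEst.measurableSet_eq_none {T : Ω → Option Θ} (hT : IsMeasurableEst 𝒢 T) :
    MeasurableSet[𝒢] {ω | T ω = none} := by
  have : {ω | T ω = none} = {ω | ∃ θ ∈ (univ : Set Θ), T ω = some θ}ᶜ := by
    ext ω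
    cases h : T ω <;> simp [h]
  rw [this]
  exact (hT univ MeasurableSet.univ).compl

lemma IsMeasurableEst.measurable_comp {F : Type*} [MeasurableSpace F] {T : Ω → Option Θ}
    (hT : IsMeasurableEst 𝒢 T) {g : Option Θ → F} (hg : Measurable fun θ : Θ => g (some θ)) :
    Measurable[𝒢] fun ω => g (T ω) := by
  classical
  intro B hB
  have : (fun ω => g (T ω)) ⁻¹' B = {ω | ∃ θ ∈ (fun θ : Θ => g (some θ)) ⁻¹' B, T ω = some θ} ∪
      ({ω | T ω = none} ∩ {_ω | g none ∈ B}) := by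
    ext ω
    cases h : T ω <;> simp [h, -Subtype.exists]
  rw [this]
  exact (hT _ (hg hB)).union (hT.measurableSet_eq_none.inter (MeasurableSet.const _))

lemma IsMeasurableEst.mono {𝒢' : MeasurableSpace Ω} (h : 𝒢 ≤ 𝒢') {T : Ω → Option Θ}
    (hT : IsMeasurableEst 𝒢 T) : IsMeasurableEst 𝒢' T := fun B hB => h _ (hT B hB)

/-- The completed data $\sigma$-field lies in the completion of the ambient one, and null measurable
maps into a countably generated space are almost everywhere measurable. -/
lemma IsMeasurableEst.aemeasurable_comp (h𝒢 : 𝒢 ≤ mΩ) {F : Type*} [MeasurableSpace F]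
    [MeasurableSpace.CountablyGenerated F] [Nonempty F]
    {T : Ω → Option Θ} (hT : IsMeasurableEst (eventuallyMeasurableSpace 𝒢 (ae Pr)) T)
    {g : Option Θ → F} (hg : Measurable fun θ : Θ => g (some θ)) :
    AEMeasurable (fun ω => g (T ω)) Pr := by
  have hmono : eventuallyMeasurableSpace 𝒢 (ae Pr) ≤ eventuallyMeasurableSpace mΩ (ae Pr) := by
    rintro s ⟨t, ht, hst⟩
    exact ⟨t, h𝒢 _ ht, hst⟩
  exact NullMeasurable.aemeasurable ((hT.mono hmono).measurable_comp hg)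

variable {ℱ : MeasurableSpace Ω} {G : EuclideanSpace ℝ (Fin p) → Ω → EuclideanSpace ℝ (Fin p)}
  {T : Ω → Option Θ}

lemma IsGEstimator.eq_zero (hT : IsGEstimator ℱ G T) {ω : Ω} {θ : Θ} (h : T ω = some θ) :
    G θ ω = 0 := by
  by_cases hω : ω ∈ estDomain Θ G
  · obtain ⟨θ', h1, h2⟩ := hT.root ω hω
    rw [h, Option.some.injEq] at h1
    rwa [h1]
  · simp [hT.outside ω hω] at h

lemma IsGEstimator.exists_eq_some (hT : IsGEstimator ℱ G T) {ω : Ω} {θ : Θ} (h : G θ ω = 0) :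
    ∃ θ' : Θ, T ω = some θ' := by
  obtain ⟨θ', h1, -⟩ := hT.root ω ⟨θ, θ.2, h⟩
  exact ⟨θ', h1⟩

lemma IsCenteredGEstimator.isGEstimator {ψ : Θ ≃ₜ EuclideanSpace ℝ (Fin p)} {ρ : Θ}
    (hT : IsCenteredGEstimator ℱ G ψ ρ T) : IsGEstimator ℱ G T where
  measurable := hT.measurable
  root ω hω := by
    obtain ⟨θ, h1, h2, -⟩ := hT.argmin ω hω
    exact ⟨θ, h1, h2⟩
  outside := hT.outside

lemma distTo_nonneg (θ₀ : Θ) (a : Option Θ) : 0 ≤ distTo θ₀ a := by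
  cases a
  · exact zero_le_one
  · exact dist_nonneg

lemma exists_of_distTo_lt {θ₀ : Θ} {a : Option Θ} {r : ℝ} (hr : r ≤ 1) (h : distTo θ₀ a < r) :
    ∃ θ : Θ, a = some θ ∧ (θ : EuclideanSpace ℝ (Fin p)) ∈
      Metric.ball (θ₀ : EuclideanSpace ℝ (Fin p)) r := by
  cases a with
  | none => exact absurd (h.trans_le hr) (lt_irrefl 1)
  | some θ => exact ⟨θ, rfl, h⟩

end Estimators

/-! ### From asymptotic linearity to consistency and normality -/

section ZEstimation

variable {Ω : Type*} [mΩ : MeasurableSpace Ω] {Pr : Measure Ω} [IsProbabilityMeasure Pr] {p : ℕ}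
  {Θ : Set (EuclideanSpace ℝ (Fin p))}

lemma weaklyConsistent_iff {θ₀ : Θ} {T : ℕ → Ω → Option Θ} :
    WeaklyConsistent Pr θ₀ T ↔
      ∀ ε : ℝ, 0 < ε → Tendsto (fun n => Pr {ω | ¬ distTo θ₀ (T n ω) < ε}) atTop (𝓝 0) := by
  unfold WeaklyConsistent
  rw [tendstoInMeasure_iff_norm]
  simp only [sub_zero, Real.norm_eq_abs, abs_of_nonneg (distTo_nonneg _ _), not_lt]

/-- Subadditivity for sequences of events with vanishing probability. -/
lemma tendsto_measure_zero_of_subset {q q₁ q₂ : ℕ → Ω → Prop}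
    (h₁ : Tendsto (fun n => Pr {ω | ¬ q₁ n ω}) atTop (𝓝 0))
    (h₂ : Tendsto (fun n => Pr {ω | ¬ q₂ n ω}) atTop (𝓝 0))
    (h : ∀ᶠ n in atTop, ∀ ω, q₁ n ω → q₂ n ω → q n ω) :
    Tendsto (fun n => Pr {ω | ¬ q n ω}) atTop (𝓝 0) := by
  have h3 := h₁.add h₂
  rw [add_zero] at h3
  refine tendsto_of_tendsto_of_tendsto_of_le_of_le' tendsto_const_nhds h3
    (Eventually.of_forall fun n => zero_le) ?_
  filter_upwards [h] with n hn
  refine (measure_mono fun ω hω => ?_).trans (measure_union_le _ _)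
  by_contra hcon
  simp only [mem_union, mem_ofPred_eq, not_or, not_not] at hcon
  exact hω (hn ω hcon.1 hcon.2)

/-- Asymptotic properties of estimating functions that yield consistent, asymptotically normal
roots. -/
structure AsymptoticallyLinear (Pr : Measure Ω) [IsProbabilityMeasure Pr]
    (G : ℕ → EuclideanSpace ℝ (Fin p) → Ω → EuclideanSpace ℝ (Fin p))
    (θ₀ : EuclideanSpace ℝ (Fin p))
    (A A' : EuclideanSpace ℝ (Fin p) →L[ℝ] EuclideanSpace ℝ (Fin p))
    (S : Matrix (Fin p) (Fin p) ℝ) : Prop where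
  leftInverse : ∀ v, A' (A v) = v
  rightInverse : ∀ v, A (A' v) = v
  approx : ∀ c : ℝ≥0, 0 < c → ∃ r, 0 < r ∧ EventuallyAS Pr fun n ω =>
    ApproximatesLinearOn (fun θ => G n θ ω) A (Metric.ball θ₀ r) c
  small : ∀ ε : ℝ, 0 < ε → EventuallyAS Pr fun n ω => ‖G n θ₀ ω‖ < ε
  clt : TendstoInDistribution (fun (n : ℕ) ω => √(n : ℝ) • -A' (G n θ₀ ω)) atTop
    (id : EuclideanSpace ℝ (Fin p) → EuclideanSpace ℝ (Fin p)) (fun _ => Pr)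
    (multivariateGaussian 0 S)

variable {G : ℕ → EuclideanSpace ℝ (Fin p) → Ω → EuclideanSpace ℝ (Fin p)}
  {θ₀ : Θ} {A A' : EuclideanSpace ℝ (Fin p) →L[ℝ] EuclideanSpace ℝ (Fin p)}
  {S : Matrix (Fin p) (Fin p) ℝ}

/-- Adding 1 keeps the bound positive even when $p=0$, where the operator norm is 0. -/
lemma exists_pos_norm_le (A' : EuclideanSpace ℝ (Fin p) →L[ℝ] EuclideanSpace ℝ (Fin p)) :
    ∃ K : ℝ, 0 < K ∧ ‖A'‖ ≤ K := ⟨‖A'‖ + 1, by positivity, by linarith⟩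

lemma AsymptoticallyLinear.eventuallyAS_root (hG : AsymptoticallyLinear Pr G θ₀ A A' S)
    (hθ₀ : (θ₀ : EuclideanSpace ℝ (Fin p)) ∈ interior Θ) {ε : ℝ} (hε : 0 < ε) :
    EventuallyAS Pr fun n ω => ∃ θ : Θ, dist θ θ₀ ≤ ε ∧ G n θ ω = 0 := by
  obtain ⟨K, hK0, hK⟩ := exists_pos_norm_le A'
  obtain ⟨r₁, hr₁, hball⟩ := Metric.isOpen_iff.1 isOpen_interior _ hθ₀
  let c : ℝ≥0 := ⟨1 / (2 * K), by positivity⟩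
  have hc : 0 < c := by change (0 : ℝ) < 1 / (2 * K); positivity
  obtain ⟨r, hr, hap⟩ := hG.approx c hc
  -- The three bounds give the required precision, stay where `G n` is nearly linear, and stay
  -- inside $\Theta$.
  let ε' := min ε (min (r / 2) (r₁ / 2))
  have hε' : 0 < ε' := by positivity
  have h1 : ε' ≤ r / 2 := (min_le_right _ _).trans (min_le_left _ _)
  have h2 : ε' ≤ r₁ / 2 := (min_le_right _ _).trans (min_le_right _ _)
  refine (hap.and (hG.small (ε' / (2 * K)) (by positivity))).mono fun n ω ⟨h3, h4⟩ => ?_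
  obtain ⟨θ, hθ, hθ0⟩ := ApproximatesLinearOn.exists_root h3 hG.rightInverse hK hK0 le_rfl hε'.le
    (by linarith) h4.le
  have hθΘ : θ ∈ Θ := interior_subset (hball (Metric.closedBall_subset_ball (by linarith) hθ))
  exact ⟨⟨θ, hθΘ⟩, (Metric.mem_closedBall.1 hθ).trans (min_le_left _ _), hθ0⟩

/-- Two weakly consistent sequences of roots both lie, with probability tending to one, in a ball
that holds at most one root. -/
lemma AsymptoticallyLinear.eventuallyUnique (hG : AsymptoticallyLinear Pr G θ₀ A A' S)
    {ℱ : ℕ → MeasurableSpace Ω} {T : ℕ → Ω → Option Θ}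
    (hT : ∀ n, IsGEstimator (ℱ n) (G n) (T n)) (hTc : WeaklyConsistent Pr θ₀ T) :
    EventuallyUnique Pr ℱ G θ₀ T := by
  intro T' hT' hTc'
  obtain ⟨K, hK0, hK⟩ := exists_pos_norm_le A'
  let c : ℝ≥0 := ⟨1 / (2 * K), by positivity⟩
  have hc : 0 < c := by change (0 : ℝ) < 1 / (2 * K); positivity
  obtain ⟨r, hr, hap⟩ := hG.approx c hc
  -- A radius of at most 1 excludes $\delta$, whose distance to `θ₀` is exactly 1.
  have hr' : 0 < min r 1 := by positivity
  have h1 := tendsto_measure_zero_of_subset (weaklyConsistent_iff.1 hTc _ hr')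
    (weaklyConsistent_iff.1 hTc' _ hr') (q := fun n ω => distTo θ₀ (T n ω) < min r 1 ∧
      distTo θ₀ (T' n ω) < min r 1) (Eventually.of_forall fun n ω h h' => ⟨h, h'⟩)
  refine tendsto_measure_zero_of_subset hap.tendsto_measure h1 (q := fun n ω => T n ω = T' n ω)
    (Eventually.of_forall fun n ω h ⟨h', h''⟩ => ?_)
  obtain ⟨θ, hθ, hθr⟩ := exists_of_distTo_lt (min_le_right _ _) h'
  obtain ⟨θ', hθ', hθr'⟩ := exists_of_distTo_lt (min_le_right _ _) h''
  have hsub := Metric.ball_subset_ball (x := (θ₀ : EuclideanSpace ℝ (Fin p))) (min_le_left r 1)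
  rw [hθ, hθ', Option.some.injEq]
  exact Subtype.ext (ApproximatesLinearOn.root_unique h hG.leftInverse hK hK0 le_rfl (hsub hθr)
    (hsub hθr') ((hT n).eq_zero hθ) ((hT' n).eq_zero hθ'))

/-- Weakly consistent roots are asymptotically normal. -/
lemma AsymptoticallyLinear.asymptoticallyNormal (hG : AsymptoticallyLinear Pr G θ₀ A A' S)
    {𝒢 : ℕ → MeasurableSpace Ω} (h𝒢 : ∀ n, 𝒢 n ≤ mΩ) {T : ℕ → Ω → Option Θ}
    (hT : ∀ n, IsGEstimator (eventuallyMeasurableSpace (𝒢 n) (ae Pr)) (G n) (T n))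
    (hTc : WeaklyConsistent Pr θ₀ T) : AsymptoticallyNormal Pr θ₀ T S := by
  obtain ⟨K, hK0, hK⟩ := exists_pos_norm_le A'
  refine ⟨?_, tendstoInDistribution_of_relatively_close hG.clt (fun n => ?_) fun δ hδ => ?_⟩
  · refine tendsto_of_tendsto_of_tendsto_of_le_of_le tendsto_const_nhds
      (weaklyConsistent_iff.1 hTc 1 one_pos) (fun n => zero_le) fun n => measure_mono ?_
    intro ω hω
    change ¬ distTo θ₀ (T n ω) < 1
    rw [show T n ω = none from hω]
    exact lt_irrefl 1
  · have hdev : AEMeasurable (fun ω => deviation θ₀ (T n ω)) Pr :=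
      IsMeasurableEst.aemeasurable_comp (h𝒢 n) (hT n).measurable
        (measurable_subtype_coe.sub_const _)
    exact hdev.const_smul (√(n : ℝ))
  -- The first bound permits comparison with the Newton step; the second makes the relative error
  -- $2Kc$ at most `δ`. As the error is relative, the factor $\sqrt n$ cancels.
  · let c : ℝ≥0 := ⟨min (1 / (2 * K)) (δ / (2 * K)), by positivity⟩
    have hc : 0 < c := by
      change (0 : ℝ) < min (1 / (2 * K)) (δ / (2 * K))
      positivity
    obtain ⟨r, hr, hap⟩ := hG.approx c hc
    have hr' : 0 < min r 1 := by positivity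
    refine tendsto_measure_zero_of_subset hap.tendsto_measure
      (weaklyConsistent_iff.1 hTc _ hr') (Eventually.of_forall fun n ω h h' => ?_)
    obtain ⟨θ, hθ, hθr⟩ := exists_of_distTo_lt (min_le_right _ _) h'
    have hle := ApproximatesLinearOn.norm_root_sub_le h hG.leftInverse hK hK0 (min_le_left _ _)
      (Metric.ball_subset_ball (min_le_left r 1) hθr) ((hT n).eq_zero hθ)
    have hcδ : 2 * K * (c : ℝ) ≤ δ := by
      calc 2 * K * (c : ℝ) ≤ 2 * K * (δ / (2 * K)) := by gcongr; exact min_le_right _ _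
        _ = δ := by field_simp
    rw [hθ, ← smul_sub, norm_smul, norm_smul, norm_neg, mul_left_comm]
    gcongr
    exact hle.trans (by gcongr)

/-- Estimators that are in a compact set with probability tending to one, and are asymptotically
close to `θ₀` there, are weakly consistent. -/
lemma weaklyConsistent_of_mem {K : Set (EuclideanSpace ℝ (Fin p))} {T : ℕ → Ω → Option Θ}
    (hK : Tendsto (fun n => Pr {ω | ¬ ∃ θ : Θ, T n ω = some θ ∧
      (θ : EuclideanSpace ℝ (Fin p)) ∈ K}) atTop (𝓝 0))
    (hε : ∀ ε : ℝ, 0 < ε → Tendsto (fun n => Pr {ω | ∃ θ : Θ, T n ω = some θ ∧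
      (θ : EuclideanSpace ℝ (Fin p)) ∈ K ∧ ε < dist θ θ₀}) atTop (𝓝 0)) :
    WeaklyConsistent Pr θ₀ T := by
  rw [weaklyConsistent_iff]
  intro ε hε0
  have h1 := hε (ε / 2) (by positivity)
  refine tendsto_measure_zero_of_subset hK (q₂ := fun n ω => ¬ ∃ θ : Θ, T n ω = some θ ∧
      (θ : EuclideanSpace ℝ (Fin p)) ∈ K ∧ ε / 2 < dist θ θ₀) (by simpa only [not_not] using h1)
    (Eventually.of_forall ?_)
  rintro n ω ⟨θ, hθ, hθK⟩ hno
  rw [hθ]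
  have : dist θ θ₀ ≤ ε / 2 := le_of_not_gt fun hlt => hno ⟨θ, hθ, hθK, hlt⟩
  exact this.trans_lt (by linarith)

end ZEstimation

/-! ### Absence of roots where the mean does not vanish -/

section Global

variable {Ω 𝒳 : Type*} [MeasurableSpace Ω] [MeasurableSpace 𝒳] {Pr : Measure Ω}
  [IsProbabilityMeasure Pr] {ν : Measure 𝒳} {X : ℕ → Ω → 𝒳}
  {E : Type*} [NormedAddCommGroup E] [NormedSpace ℝ E] [MeasurableSpace E] [BorelSpace E]
  [SecondCountableTopology E] [CompleteSpace E] {f : 𝒳 → E → E} {K : Set E} {H : 𝒳 → ℝ}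

/-- Oscillation of `f x` around `a` over the points of `s` (along a countable dense subset). -/
def oscillation (f : 𝒳 → E → E) (s : Set E) [Nonempty s] (a : E) (x : 𝒳) : ℝ :=
  ⨆ k : ℕ, ‖f x (TopologicalSpace.denseSeq s k) - f x a‖

lemma oscillation_le {s : Set E} [Nonempty s] {a : E} {x : 𝒳} {C : ℝ}
    (h : ∀ θ ∈ s, ‖f x θ - f x a‖ ≤ C) : oscillation f s a x ≤ C :=
  ciSup_le fun k => h _ (TopologicalSpace.denseSeq s k).2

lemma oscillation_nonneg {s : Set E} [Nonempty s] {a : E} {x : 𝒳} : 0 ≤ oscillation f s a x :=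
  Real.iSup_nonneg fun _ => norm_nonneg _

lemma norm_sub_le_oscillation {s : Set E} [Nonempty s] {a : E} {x : 𝒳} {C : ℝ}
    (h : ∀ θ ∈ s, ‖f x θ - f x a‖ ≤ C) (hc : ContinuousOn (f x) s) {θ : E} (hθ : θ ∈ s) :
    ‖f x θ - f x a‖ ≤ oscillation f s a x := by
  have hcont : Continuous fun θ : s => ‖f x θ - f x a‖ :=
    ((continuousOn_iff_continuous_domRestrict.1 hc).sub continuous_const).norm
  have hcl : IsClosed {θ : s | ‖f x θ - f x a‖ ≤ oscillation f s a x} :=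
    isClosed_le hcont continuous_const
  have hbdd : BddAbove (range fun k : ℕ => ‖f x (TopologicalSpace.denseSeq s k) - f x a‖) := by
    refine ⟨C, ?_⟩
    rintro _ ⟨k, rfl⟩
    exact h _ (TopologicalSpace.denseSeq s k).2
  have huniv := (TopologicalSpace.denseRange_denseSeq s).closure_eq ▸
    hcl.closure_subset_iff.2 (range_subset_iff.2 fun k => le_ciSup hbdd k)
  exact huniv (mem_univ (⟨θ, hθ⟩ : s))

lemma measurable_oscillation {s : Set E} [Nonempty s] {a : E} (ha : Measurable fun x => f x a)
    (hs : ∀ θ ∈ s, Measurable fun x => f x θ) : Measurable (oscillation f s a) :=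
  Measurable.iSup fun k => ((hs _ (TopologicalSpace.denseSeq s k).2).sub ha).norm

/-- Wald's argument: averages have no roots in a compact set on which the mean does not vanish. -/
lemma eventuallyAS_average_ne_zero (hX : ∀ i, MeasurePreserving (X i) Pr ν)
    (hind : iIndepFun X Pr) (hK : IsCompact K) (hm : ∀ θ ∈ K, Measurable fun x => f x θ)
    (hc : ∀ x, ContinuousOn (f x) K) (hH : Integrable H ν) (hb : ∀ x, ∀ θ ∈ K, ‖f x θ‖ ≤ H x)
    (hne : ∀ θ ∈ K, ∫ x, f x θ ∂ν ≠ 0) :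
    EventuallyAS Pr fun n ω => ∀ θ ∈ K, average f X n θ ω ≠ 0 := by
  refine hK.induction_on (p := fun s => EventuallyAS Pr fun n ω => ∀ θ ∈ s, average f X n θ ω ≠ 0)
    ?_ ?_ ?_ ?_
  · exact EventuallyAS.of_forall_ge 0 (by simp)
  · exact fun s t hst ht => ht.mono fun n ω h θ hθ => h θ (hst hθ)
  · intro s t hs ht
    refine (hs.and ht).mono ?_
    rintro n ω ⟨h1, h2⟩ θ (hθ | hθ)
    exacts [h1 θ hθ, h2 θ hθ]
  · intro a ha
    -- Shrinking neighbourhoods of `a` in `K`. The mean oscillation over them tends to zero by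
    -- dominated convergence.
    let s : ℕ → Set E := fun k => K ∩ Metric.ball a (1 / ((k : ℝ) + 1))
    have hne' : ∀ k, Nonempty (s k) := fun k =>
      ⟨⟨a, ha, Metric.mem_ball_self (by positivity)⟩⟩
    have hosc2 : ∀ k x, ∀ θ ∈ s k, ‖f x θ - f x a‖ ≤ 2 * H x := fun k x θ hθ =>
      (norm_sub_le _ _).trans (by linarith [hb x θ hθ.1, hb x a ha])
    have hwm : ∀ k, Measurable (oscillation f (s k) a) := fun k =>
      measurable_oscillation (hm a ha) fun θ hθ => hm θ hθ.1
    have hwle : ∀ k x, ‖oscillation f (s k) a x‖ ≤ 2 * H x := fun k x => by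
      rw [Real.norm_eq_abs, abs_of_nonneg oscillation_nonneg]
      exact oscillation_le (hosc2 k x)
    have hlim : Tendsto (fun k => ∫ x, oscillation f (s k) a x ∂ν) atTop (𝓝 0) := by
      rw [← integral_zero 𝒳 ℝ (μ := ν)]
      refine tendsto_integral_of_dominated_convergence (fun x => 2 * H x)
        (fun k => (hwm k).aestronglyMeasurable) (hH.const_mul 2)
        (fun k => Eventually.of_forall (hwle k)) (Eventually.of_forall fun x => ?_)
      rw [Metric.tendsto_atTop]
      intro ε hε
      obtain ⟨δ, hδ, hball⟩ := Metric.continuousWithinAt_iff.1 (hc x a ha) (ε / 2) (by positivity)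
      obtain ⟨N, hN⟩ := exists_nat_one_div_lt hδ
      refine ⟨N, fun k hk => ?_⟩
      rw [Real.dist_eq, sub_zero, abs_of_nonneg oscillation_nonneg]
      refine (oscillation_le (C := ε / 2) fun θ hθ => ?_).trans_lt (by linarith)
      rw [← dist_eq_norm]
      exact (hball hθ.1 ((Metric.mem_ball.1 hθ.2).trans
        ((Nat.one_div_le_one_div hk).trans_lt hN))).le
    set μ := ∫ x, f x a ∂ν with hμ
    -- At a root in `s k` the average at `a` would have norm below $2\|\mu\|/3$, while it lies
    -- within $\|\mu\|/3$ of `μ`.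
    have hpos : 0 < ‖μ‖ / 3 := by
      have := norm_pos_iff.2 (hne a ha)
      positivity
    obtain ⟨k, hk⟩ := (hlim.eventually_lt_const hpos).exists
    refine ⟨s k, inter_mem_nhdsWithin _ (Metric.ball_mem_nhds a (by positivity)), ?_⟩
    have h1 := eventuallyAS_dist_average_lt hX hind (hwm k)
      ((hH.const_mul 2).mono' (hwm k).aestronglyMeasurable (Eventually.of_forall (hwle k))) hpos
    have h2 := eventuallyAS_dist_average_lt hX hind (hm a ha)
      (hH.mono' (hm a ha).aestronglyMeasurable (Eventually.of_forall fun x => hb x a ha)) hpos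
    refine (h1.and h2).mono fun n ω ⟨h1, h2⟩ θ hθ h0 => ?_
    have hdiff : ‖average f X n θ ω - average f X n a ω‖ ≤
        (n : ℝ)⁻¹ • ∑ i ∈ Finset.range n, oscillation f (s k) a (X i ω) := by
      rw [average, average, ← smul_sub, ← Finset.sum_sub_distrib, norm_smul, norm_inv,
        Real.norm_natCast, smul_eq_mul]
      gcongr
      exact norm_sum_le_of_le _ fun i _ =>
        norm_sub_le_oscillation (hosc2 k _) ((hc _).mono inter_subset_left) hθ
    rw [h0, zero_sub, norm_neg] at hdiff
    rw [Real.dist_eq] at h1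
    have h1' := (abs_lt.1 h1).2
    change dist (average f X n a ω) μ < _ at h2
    rw [dist_eq_norm, ← norm_neg, neg_sub] at h2
    have h3 := norm_sub_norm_le μ (average f X n a ω)
    linarith

end Global

/-! ### Integrable envelopes along curves of bounded length -/

section Envelope

variable {E : Type*} [NormedAddCommGroup E] [NormedSpace ℝ E]

/-- Growth of a differentiable function along a Lipschitz curve. -/
lemma norm_le_of_lipschitz_curve {g : E → E} {g' : E → E →L[ℝ] E} {s M : Set E} (hMs : M ⊆ s)
    (hg : ∀ θ ∈ s, HasFDerivWithinAt g (g' θ) s θ) {C : ℝ} (hC : ∀ θ ∈ M, ‖g' θ‖ ≤ C)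
    {γ : ℝ → E} {L : ℝ≥0} (hγ : LipschitzOnWith L γ (Icc 0 1)) (hγM : MapsTo γ (Icc 0 1) M) :
    ‖g (γ 1)‖ ≤ ‖g (γ 0)‖ + (L * C + 1) := by
  have hC0 : 0 ≤ C := (norm_nonneg _).trans (hC _ (hγM (left_mem_Icc.2 zero_le_one)))
  have hcont : ContinuousOn (fun t => g (γ t)) (Icc 0 1) := by
    have hgc : ContinuousOn g s := fun θ hθ => (hg θ hθ).continuousWithinAt
    exact hgc.comp hγ.continuousOn fun t ht => hMs (hγM ht)
  -- `γ` need not be differentiable, so right slopes are compared instead. The comparison needs a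
  -- strict inequality of slopes, whence the harmless extra 1.
  have hmain := image_norm_le_of_liminf_right_slope_norm_lt_deriv_boundary (f' := fun _ => L * C)
    (B := fun t => ‖g (γ 0)‖ + (L * C + 1) * t) (B' := fun _ => L * C + 1) hcont ?_ (by simp)
    (by fun_prop) (fun t _ => ?_) (fun t _ _ => lt_add_one _) (right_mem_Icc.2 zero_le_one)
  · simpa using hmain
  · intro t ht ρ hρ
    refine Eventually.frequently ?_
    have htI : t ∈ Icc (0 : ℝ) 1 := Ico_subset_Icc_self ht
    -- `η` pays for the first-order remainder of `g` at `γ t`.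
    obtain ⟨η, hη, hηρ⟩ : ∃ η : ℝ, 0 < η ∧ (C + η) * L < ρ := by
      have hcl : Tendsto (fun η : ℝ => (C + η) * L) (𝓝[>] 0) (𝓝 ((C + 0) * L)) :=
        ((continuous_const.add continuous_id).mul continuous_const).continuousWithinAt.tendsto
      have h2 : (C + 0) * L < ρ := by rw [add_zero, mul_comm]; exact hρ
      obtain ⟨η, h3, h4⟩ := ((hcl.eventually_lt_const h2).and self_mem_nhdsWithin).exists
      exact ⟨η, h4, h3⟩
    have hIcc : Icc (0 : ℝ) 1 ∈ 𝓝[>] t := by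
      have : Ioc t 1 ∈ 𝓝[>] t := Ioc_mem_nhdsGT ht.2
      exact mem_of_superset this fun z hz => ⟨ht.1.trans hz.1.le, hz.2⟩
    have hγt : Tendsto γ (𝓝[>] t) (𝓝[s] (γ t)) := by
      refine tendsto_nhdsWithin_iff.2 ⟨?_, mem_of_superset hIcc fun z hz => hMs (hγM hz)⟩
      exact (hγ.continuousOn t htI).tendsto.mono_left (nhdsWithin_le_of_mem hIcc)
    have hlo := hγt.eventually ((hg (γ t) (hMs (hγM htI))).isLittleO.def hη)
    filter_upwards [hlo, hIcc, self_mem_nhdsWithin] with z hz hzI hzt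
    have hzt' : 0 < z - t := sub_pos.2 hzt
    have hL : ‖γ z - γ t‖ ≤ L * (z - t) := by
      have := hγ.dist_le_mul z hzI t htI
      rwa [dist_eq_norm, Real.dist_eq, abs_of_pos hzt'] at this
    have hdiff : ‖g (γ z)‖ - ‖g (γ t)‖ ≤ (C + η) * L * (z - t) := by
      calc ‖g (γ z)‖ - ‖g (γ t)‖ ≤ ‖g (γ z) - g (γ t)‖ := norm_sub_norm_le _ _
        _ = ‖(g (γ z) - g (γ t) - g' (γ t) (γ z - γ t)) + g' (γ t) (γ z - γ t)‖ := by
            rw [sub_add_cancel]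
        _ ≤ η * ‖γ z - γ t‖ + C * ‖γ z - γ t‖ :=
            (norm_add_le _ _).trans (add_le_add hz ((g' (γ t)).le_of_opNorm_le (hC _ (hγM htI)) _))
        _ = (C + η) * ‖γ z - γ t‖ := by ring
        _ ≤ (C + η) * (L * (z - t)) := by gcongr
        _ = (C + η) * L * (z - t) := by ring
    rw [slope_def_field]
    refine lt_of_le_of_lt ?_ hηρ
    exact (div_le_iff₀ hzt').2 hdiff
  · have h1 : HasDerivAt (fun t : ℝ => ‖g (γ 0)‖ + (L * C + 1) * t) (L * C + 1) t := by
      simpa using ((hasDerivAt_id t).const_mul ((L : ℝ) * C + 1)).const_add ‖g (γ 0)‖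
    exact h1.hasDerivWithinAt

variable {D : Type*} [MeasurableSpace D] {p : ℕ} {Θ : Set (EuclideanSpace ℝ (Fin p))}
  {Q : Measure (D × D)} {h : D → D → EuclideanSpace ℝ (Fin p) → EuclideanSpace ℝ (Fin p)}
  {θ₀ : EuclideanSpace ℝ (Fin p)}

lemma RegularityCondition.hasFDerivWithinAt (hreg : RegularityCondition Θ Q h θ₀) (x₁ x₂ : D)
    {θ : EuclideanSpace ℝ (Fin p)} (hθ : θ ∈ Θ) :
    HasFDerivWithinAt (h x₁ x₂) (dh Θ h x₁ x₂ θ) Θ θ :=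
  ((hreg.contDiff x₁ x₂).differentiableOn one_ne_zero θ hθ).hasFDerivWithinAt

/-- On a compact subset of a rectifiably accessible set, `h` has an integrable envelope. -/
lemma RegularityCondition.exists_envelope [IsFiniteMeasure Q]
    (hreg : RegularityCondition Θ Q h θ₀) (hΘ : RectifiablyAccessible Θ)
    {K : Set (EuclideanSpace ℝ (Fin p))} (hKΘ : K ⊆ Θ) (hK : IsCompact K) :
    ∃ H : D × D → ℝ, Integrable H Q ∧ ∀ θ ∈ K, ∀ z : D × D, ‖h z.1 z.2 θ‖ ≤ H z := by
  obtain ⟨M, hMΘ, hM, F, hFM, hF, L, hcurve⟩ := hΘ K hKΘ hK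
  obtain ⟨hbar, hbi, hbar_le⟩ := hreg.dominated M hMΘ hM
  -- The sum over the finite set `F` bounds every starting value, whichever point the curve leaves
  -- from; the rest bounds the growth along a curve.
  refine ⟨fun z => ∑ a ∈ hF.toFinset, ‖h z.1 z.2 a‖ + (L * hbar z + 1), ?_, ?_⟩
  · refine (integrable_finsetSum _ fun a ha => ?_).add ((hbi.const_mul _).add (integrable_const _))
    exact ((hreg.sq_integrable a (hMΘ (hFM (hF.mem_toFinset.1 ha)))).integrable one_le_two).norm
  · intro θ hθ z
    obtain ⟨γ, hγ, hγM, hγ0, rfl⟩ := hcurve θ hθ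
    have h1 := norm_le_of_lipschitz_curve hMΘ
      (fun θ hθ => hreg.hasFDerivWithinAt z.1 z.2 hθ) (fun θ hθ => hbar_le θ hθ z) hγ hγM
    have h2 : ‖h z.1 z.2 (γ 0)‖ ≤ ∑ a ∈ hF.toFinset, ‖h z.1 z.2 a‖ :=
      Finset.single_le_sum (f := fun a => ‖h z.1 z.2 a‖) (fun _ _ => norm_nonneg _)
        (hF.mem_toFinset.2 hγ0)
    linarith

end Envelope

/-! ### Measurability and continuity of the derivative -/

section Regularity

variable {D : Type*} [MeasurableSpace D] {p : ℕ} {Θ : Set (EuclideanSpace ℝ (Fin p))}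
  {Q : Measure (D × D)} {h : D → D → EuclideanSpace ℝ (Fin p) → EuclideanSpace ℝ (Fin p)}
  {θ₀ : EuclideanSpace ℝ (Fin p)}

lemma measurable_estimating_function
    (hh : Measurable fun z : D × D × Θ => h z.1 z.2.1 z.2.2) {θ : EuclideanSpace ℝ (Fin p)}
    (hθ : θ ∈ Θ) : Measurable fun z : D × D => h z.1 z.2 θ :=
  hh.comp (f := fun z : D × D => (z.1, z.2, (⟨θ, hθ⟩ : Θ))) (by fun_prop)

lemma RegularityCondition.hasFDerivAt (hreg : RegularityCondition Θ Q h θ₀) (x₁ x₂ : D)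
    {θ : EuclideanSpace ℝ (Fin p)} (hθ : θ ∈ interior Θ) :
    HasFDerivAt (h x₁ x₂) (dh Θ h x₁ x₂ θ) θ :=
  (hreg.hasFDerivWithinAt x₁ x₂ (interior_subset hθ)).hasFDerivAt (mem_interior_iff_mem_nhds.1 hθ)

/-- On the interior of $\Theta$ the relative derivative is the ordinary one, which is continuous
there. -/
lemma RegularityCondition.continuousAt_dh (hreg : RegularityCondition Θ Q h θ₀) (x₁ x₂ : D)
    (hθ₀ : θ₀ ∈ interior Θ) : ContinuousAt (dh Θ h x₁ x₂) θ₀ := by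
  have h1 : ContinuousOn (fderiv ℝ (h x₁ x₂)) (interior Θ) :=
    ((hreg.contDiff x₁ x₂).mono interior_subset).continuousOn_fderiv_of_isOpen isOpen_interior
      le_rfl
  have hnhds : interior Θ ∈ 𝓝 θ₀ := isOpen_interior.mem_nhds hθ₀
  refine (h1.continuousAt hnhds).congr ?_
  filter_upwards [hnhds] with θ hθ
  exact (hreg.hasFDerivAt x₁ x₂ hθ).fderiv

/-- Measurability of a matrix-valued map from that of its columns. -/
lemma measurable_clm_of_apply {𝒳 : Type*} [MeasurableSpace 𝒳]
    {A : 𝒳 → EuclideanSpace ℝ (Fin p) →L[ℝ] EuclideanSpace ℝ (Fin p)}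
    (hA : ∀ v, Measurable fun x => A x v) : Measurable A := by
  have heq : A = fun x => ∑ l : Fin p, ContinuousLinearMap.smulRightL ℝ _ _
      (EuclideanSpace.proj l : EuclideanSpace ℝ (Fin p) →L[ℝ] ℝ)
      (A x (EuclideanSpace.single l 1)) := by
    funext x
    ext v : 1
    conv_lhs => rw [← (EuclideanSpace.basisFun (Fin p) ℝ).sum_repr v, map_sum]
    simp [sum_apply]
  rw [heq]
  exact Finset.measurable_sum _ fun l _ =>
    (ContinuousLinearMap.continuous _).measurable.comp (hA _)

/-- Directional derivatives at an interior point are pointwise limits of difference quotients, which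
are measurable in the data. -/
lemma RegularityCondition.measurable_dh (hreg : RegularityCondition Θ Q h θ₀)
    (hh : Measurable fun z : D × D × Θ => h z.1 z.2.1 z.2.2) (hθ₀ : θ₀ ∈ interior Θ) :
    Measurable fun z : D × D => dh Θ h z.1 z.2 θ₀ := by
  refine measurable_clm_of_apply fun v => ?_
  have hlim : Tendsto (fun k : ℕ => θ₀ + ((k : ℝ))⁻¹ • v) atTop (𝓝 θ₀) := by
    have := (tendsto_inv_atTop_nhds_zero_nat (𝕜 := ℝ)).smul_const v
    simpa using this.const_add θ₀
  obtain ⟨N, hN⟩ := eventually_atTop.1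
    (hlim.eventually (isOpen_interior.mem_nhds hθ₀))
  -- The shift by `N` keeps all evaluation points inside $\Theta$, the only place where `h` is known
  -- to be measurable.
  let c : ℕ → ℝ := fun k => ((k + N : ℕ) : ℝ)
  refine measurable_of_tendsto_metrizable
    (f := fun k (z : D × D) => c k • (h z.1 z.2 (θ₀ + (c k)⁻¹ • v) - h z.1 z.2 θ₀))
    (fun k => ?_) ?_
  · exact ((measurable_estimating_function hh
      (interior_subset (hN (k + N) (Nat.le_add_left N k)))).sub
      (measurable_estimating_function hh (interior_subset hθ₀))).const_smul (c k)
  · rw [tendsto_pi_nhds]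
    intro z
    refine (hreg.hasFDerivAt z.1 z.2 hθ₀).lim v ?_
    have : Tendsto c atTop atTop :=
      tendsto_natCast_atTop_atTop.comp (tendsto_add_atTop_nat N)
    exact tendsto_norm_atTop_atTop.comp this

end Regularity

/-! ### Integrability and means of path sums -/

section Paths

variable {Ω D : Type*} [MeasurableSpace Ω] [MeasurableSpace D] {Pr : Measure Ω}
  [IsProbabilityMeasure Pr] {Y : ℝ≥0 → Ω → D} {κ : ℝ≥0 → Kernel D D} {ν : Measure D} {Δ : ℝ≥0}

lemma IsMarkovProcess.integrable_pathSum (hY : IsMarkovProcess Pr Y κ ν)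
    [∀ t, IsMarkovKernel (κ t)] (hν : ∀ t, Kernel.Invariant (κ t) ν) {m : ℕ} {F : Type*}
    [NormedAddCommGroup F] {u : D → D → F}
    (hu : Integrable (fun z : D × D => u z.1 z.2) (ν ⊗ₘ κ Δ)) :
    Integrable (fun x : Fin (m + 1) → D => pathSum u x) (Pr.map (skeleton Y Δ m)) :=
  integrable_finsetSum _ fun j _ => (hY.measurePreserving_proj hν j).integrable_comp_of_integrable hu

lemma IsMarkovProcess.memLp_pathSum (hY : IsMarkovProcess Pr Y κ ν)
    [∀ t, IsMarkovKernel (κ t)] (hν : ∀ t, Kernel.Invariant (κ t) ν) {m : ℕ} {F : Type*}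
    [NormedAddCommGroup F] {u : D → D → F}
    (hu : MemLp (fun z : D × D => u z.1 z.2) 2 (ν ⊗ₘ κ Δ)) :
    MemLp (fun x : Fin (m + 1) → D => pathSum u x) 2 (Pr.map (skeleton Y Δ m)) :=
  memLp_finsetSum _ fun j _ => hu.comp_measurePreserving (hY.measurePreserving_proj hν j)

lemma IsMarkovProcess.integral_pathSum (hY : IsMarkovProcess Pr Y κ ν)
    [∀ t, IsMarkovKernel (κ t)] (hν : ∀ t, Kernel.Invariant (κ t) ν) {m : ℕ} {F : Type*}
    [NormedAddCommGroup F] [NormedSpace ℝ F] {u : D → D → F}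
    (hu : Integrable (fun z : D × D => u z.1 z.2) (ν ⊗ₘ κ Δ)) :
    ∫ x : Fin (m + 1) → D, pathSum u x ∂(Pr.map (skeleton Y Δ m))
      = (m : ℝ) • ∫ z, u z.1 z.2 ∂(ν ⊗ₘ κ Δ) := by
  unfold pathSum
  have hi : ∀ j : Fin m, Integrable (fun x : Fin (m + 1) → D => u (x j.castSucc) (x j.succ))
      (Pr.map (skeleton Y Δ m)) := fun j =>
    (hY.measurePreserving_proj hν j).integrable_comp_of_integrable hu
  rw [integral_finsetSum _ fun j _ => hi j]
  have : ∀ j : Fin m, ∫ x : Fin (m + 1) → D, u (x j.castSucc) (x j.succ)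
      ∂(Pr.map (skeleton Y Δ m)) = ∫ z, u z.1 z.2 ∂(ν ⊗ₘ κ Δ) := by
    intro j
    have hmp := hY.measurePreserving_proj (Δ := Δ) hν j
    rw [← hmp.map_eq, integral_map hmp.measurable.aemeasurable
      (hmp.map_eq ▸ hu.aestronglyMeasurable)]
  simp [this, Nat.cast_smul_eq_nsmul]

end Paths

/-! ### The mean derivative as a matrix -/

section Matrices

variable {p : ℕ}

lemma toEuclideanCLM_apply_coord (M : Matrix (Fin p) (Fin p) ℝ) (v : EuclideanSpace ℝ (Fin p))
    (k : Fin p) : Matrix.toEuclideanCLM (𝕜 := ℝ) M v k = ∑ l, M k l * v l := rfl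

/-- Evaluation at a basis vector and projection to a coordinate both commute with the Bochner
integral, so the two operators have the same entries. -/
lemma integral_dh_eq {D : Type*} [MeasurableSpace D] {Θ : Set (EuclideanSpace ℝ (Fin p))}
    {Q : Measure (D × D)} {h : D → D → EuclideanSpace ℝ (Fin p) → EuclideanSpace ℝ (Fin p)}
    {θ₀ : EuclideanSpace ℝ (Fin p)} (hi : Integrable (fun z : D × D => dh Θ h z.1 z.2 θ₀) Q) :
    ∫ z, dh Θ h z.1 z.2 θ₀ ∂Q = Matrix.toEuclideanCLM (𝕜 := ℝ) (meanJacobian Θ Q h θ₀) := by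
  refine ContinuousLinearMap.coe_injective
    ((EuclideanSpace.basisFun (Fin p) ℝ).toBasis.ext fun l => ?_)
  simp only [OrthonormalBasis.coe_toBasis, EuclideanSpace.basisFun_apply,
    ContinuousLinearMap.coe_coe]
  ext k
  rw [toEuclideanCLM_apply_coord, ContinuousLinearMap.integral_apply hi]
  have h1 : Integrable (fun z : D × D => dh Θ h z.1 z.2 θ₀ (EuclideanSpace.single l 1)) Q :=
    hi.apply_continuousLinearMap _
  have h2 : ∫ z : D × D, (dh Θ h z.1 z.2 θ₀ (EuclideanSpace.single l 1)) k ∂Q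
      = (∫ z : D × D, dh Θ h z.1 z.2 θ₀ (EuclideanSpace.single l 1) ∂Q) k :=
    (EuclideanSpace.proj k : EuclideanSpace ℝ (Fin p) →L[ℝ] ℝ).integral_comp_comm h1
  rw [← h2, Finset.sum_eq_single l]
  · simp [meanJacobian]
  · intro b _ hb
    simp [hb]
  · simp

end Matrices

/-! ### The sandwich matrix as a quadratic form -/

section Covariance

variable {D : Type*} [MeasurableSpace D] {p : ℕ} {Θ : Set (EuclideanSpace ℝ (Fin p))}
  {Q : Measure (D × D)} {h : D → D → EuclideanSpace ℝ (Fin p) → EuclideanSpace ℝ (Fin p)}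
  {θ₀ : EuclideanSpace ℝ (Fin p)}

lemma integral_inner_sq (hL2 : MemLp (fun z : D × D => h z.1 z.2 θ₀) 2 Q)
    (s : EuclideanSpace ℝ (Fin p)) :
    ∫ z : D × D, (inner ℝ (h z.1 z.2 θ₀) s) ^ 2 ∂Q = s ⬝ᵥ (meanOuter Q h θ₀).mulVec s := by
  have hcoord : ∀ k, MemLp (fun z : D × D => (h z.1 z.2 θ₀) k) 2 Q := fun k =>
    (EuclideanSpace.proj k : EuclideanSpace ℝ (Fin p) →L[ℝ] ℝ).comp_memLp' hL2
  have hint : ∀ k l, Integrable (fun z : D × D =>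
      s k * ((h z.1 z.2 θ₀) k * (h z.1 z.2 θ₀) l * s l)) Q := fun k l =>
    (((hcoord k).integrable_mul (hcoord l)).mul_const _).const_mul _
  have hsq : ∀ z : D × D, (inner ℝ (h z.1 z.2 θ₀) s) ^ 2 =
      ∑ k, ∑ l, s k * ((h z.1 z.2 θ₀) k * (h z.1 z.2 θ₀) l * s l) := by
    intro z
    rw [PiLp.inner_apply, sq, Finset.sum_mul_sum]
    refine Finset.sum_congr rfl fun k _ => Finset.sum_congr rfl fun l _ => ?_
    simp only [RCLike.inner_apply, conj_trivial]
    ring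
  simp_rw [hsq]
  rw [integral_finsetSum _ fun k _ => integrable_finsetSum _ fun l _ => hint k l]
  simp_rw [integral_finsetSum _ fun l _ => hint _ l, integral_const_mul, integral_mul_const]
  simp [dotProduct, Matrix.mulVec, meanOuter, Finset.mul_sum]

lemma meanOuter_isSymm : (meanOuter Q h θ₀).transpose = meanOuter Q h θ₀ := by
  ext k l
  simp [meanOuter, mul_comm]

lemma sandwich_eq : sandwich Θ Q h θ₀ = (meanJacobian Θ Q h θ₀)⁻¹ * meanOuter Q h θ₀ *
    ((meanJacobian Θ Q h θ₀)⁻¹).transpose := by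
  rw [sandwich, Matrix.transpose_nonsing_inv]

lemma smul_sandwich_isHermitian (a : ℝ) : (a • sandwich Θ Q h θ₀).IsHermitian := by
  rw [Matrix.IsHermitian, Matrix.conjTranspose_eq_transpose_of_trivial, sandwich_eq,
    Matrix.transpose_smul, Matrix.transpose_mul, Matrix.transpose_mul, Matrix.transpose_transpose,
    meanOuter_isSymm, Matrix.mul_assoc]

lemma inner_toEuclideanCLM_left (B : Matrix (Fin p) (Fin p) ℝ) (v t : EuclideanSpace ℝ (Fin p)) :
    inner ℝ (Matrix.toEuclideanCLM (𝕜 := ℝ) B v) t =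
      inner ℝ v (Matrix.toEuclideanCLM (𝕜 := ℝ) B.transpose t) := by
  simp only [PiLp.inner_apply, RCLike.inner_apply, conj_trivial, toEuclideanCLM_apply_coord,
    Finset.mul_sum, Finset.sum_mul, Matrix.transpose_apply]
  rw [Finset.sum_comm]
  exact Finset.sum_congr rfl fun k _ => Finset.sum_congr rfl fun l _ => by ring

/-- With $B$ the inverse Jacobian, $t\cdot B\Sigma B^*t=(B^*t)\cdot\Sigma(B^*t)$. This reduces the
limiting variance in direction `t` to the variance of $h$ in direction $B^*t$. -/
lemma dotProduct_smul_sandwich_mulVec (a : ℝ) (t : EuclideanSpace ℝ (Fin p)) :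
    t ⬝ᵥ (a • sandwich Θ Q h θ₀).mulVec t = a *
      ((Matrix.toEuclideanCLM (𝕜 := ℝ) ((meanJacobian Θ Q h θ₀)⁻¹).transpose t) ⬝ᵥ
        (meanOuter Q h θ₀).mulVec
        (Matrix.toEuclideanCLM (𝕜 := ℝ) ((meanJacobian Θ Q h θ₀)⁻¹).transpose t)) := by
  rw [Matrix.smul_mulVec, dotProduct_smul, smul_eq_mul, sandwich_eq, Matrix.ofLp_toEuclideanCLM,
    ← Matrix.mulVec_mulVec, ← Matrix.mulVec_mulVec, Matrix.mulVec_transpose,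
    ← Matrix.dotProduct_mulVec]

end Covariance

/-! ### Asymptotic linearity of the estimating functions -/

section Sample

variable {Ω D : Type*} [mΩ : MeasurableSpace Ω] [MeasurableSpace D] {Pr : Measure Ω}
  [IsProbabilityMeasure Pr] {p : ℕ} {Θ : Set (EuclideanSpace ℝ (Fin p))}
  {Mod : StationaryMarkovModel D Θ} {θ₀ : Θ} {Δ : ℝ≥0} {m : ℕ} {Y : ℕ → ℝ≥0 → Ω → D}
  {h : D → D → EuclideanSpace ℝ (Fin p) → EuclideanSpace ℝ (Fin p)}

/-- The summand of the estimating function as a function of one discretely observed path. -/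
def pathEstFun (h : D → D → EuclideanSpace ℝ (Fin p) → EuclideanSpace ℝ (Fin p)) (m : ℕ)
    (x : Fin (m + 1) → D) (θ : EuclideanSpace ℝ (Fin p)) : EuclideanSpace ℝ (Fin p) :=
  pathSum (fun a b => h a b θ) x

lemma estFun_eq_average (n : ℕ) (θ : EuclideanSpace ℝ (Fin p)) (ω : Ω) :
    estFun h Y Δ m n θ ω = average (pathEstFun h m) (fun i => skeleton (Y i) Δ m) n θ ω := by
  simp only [estFun, average, pathEstFun, pathSum_skeleton]

lemma IsIIDSample.measurePreserving_skeleton (hY : IsIIDSample Pr Mod θ₀ Y) (i : ℕ) :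
    MeasurePreserving (skeleton (Y i) Δ m) Pr (Pr.map (skeleton (Y 0) Δ m)) := by
  have := Mod.isMarkovKernel θ₀
  exact ⟨(hY.markov i).measurable_skeleton Δ m, (hY.markov i).map_skeleton_eq (hY.markov 0) Δ m⟩

lemma IsIIDSample.iIndepFun_skeleton (hY : IsIIDSample Pr Mod θ₀ Y) :
    iIndepFun (fun i => skeleton (Y i) Δ m) Pr :=
  hY.indep.comp (fun _ y (j : Fin (m + 1)) => y ((j : ℕ) * Δ))
    fun _ => measurable_pi_lambda _ fun _ => measurable_pi_apply _

instance (Mod : StationaryMarkovModel D Θ) (θ₀ : Θ) (Δ : ℝ≥0) :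
    IsProbabilityMeasure (pairLaw Mod θ₀ Δ) := by
  have := Mod.isMarkovKernel θ₀ Δ
  have := Mod.isProbabilityMeasure θ₀
  unfold pairLaw
  infer_instance

lemma measurable_pathEstFun (hh : Measurable fun z : D × D × Θ => h z.1 z.2.1 z.2.2)
    {θ : EuclideanSpace ℝ (Fin p)} (hθ : θ ∈ Θ) : Measurable fun x => pathEstFun h m x θ :=
  measurable_pathSum (measurable_estimating_function hh hθ)

lemma IsMartingaleEstFun.integral_eq_zero (hmart : IsMartingaleEstFun Mod Δ h)
    (hi : Integrable (fun z : D × D => h z.1 z.2 θ₀) (pairLaw Mod θ₀ Δ)) :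
    ∫ z, h z.1 z.2 θ₀ ∂(pairLaw Mod θ₀ Δ) = 0 := by
  have := Mod.isMarkovKernel θ₀ Δ
  have := Mod.isProbabilityMeasure θ₀
  rw [pairLaw, Measure.integral_compProd hi]
  simp [(hmart θ₀ _).2]

/-- The estimating function is locally dominated around the true parameter. -/
lemma exists_locallyDominated (hθ₀ : (θ₀ : EuclideanSpace ℝ (Fin p)) ∈ interior Θ)
    (hY : IsIIDSample Pr Mod θ₀ Y)
    (hh : Measurable fun z : D × D × Θ => h z.1 z.2.1 z.2.2)
    (hreg : RegularityCondition Θ (pairLaw Mod θ₀ Δ) h θ₀) :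
    ∃ r₀ H, LocallyDominated (Pr.map (skeleton (Y 0) Δ m)) (pathEstFun h m)
      (fun x θ => pathSum (fun a b => dh Θ h a b θ) x) (θ₀ : EuclideanSpace ℝ (Fin p)) r₀ H := by
  have := Mod.isMarkovKernel θ₀
  obtain ⟨ε, hε, hball⟩ := Metric.isOpen_iff.1 isOpen_interior _ hθ₀
  have hsub : Metric.closedBall (θ₀ : EuclideanSpace ℝ (Fin p)) (ε / 2) ⊆ interior Θ :=
    (Metric.closedBall_subset_ball (by linarith)).trans hball
  have hsub' : Metric.ball (θ₀ : EuclideanSpace ℝ (Fin p)) (ε / 2) ⊆ interior Θ :=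
    Metric.ball_subset_closedBall.trans hsub
  obtain ⟨hbar, hbi, hb⟩ := hreg.dominated _ (hsub.trans interior_subset)
    (isCompact_closedBall _ _)
  refine ⟨ε / 2, fun x => pathSum (fun a b => hbar (a, b)) x, ?_⟩
  refine ⟨by positivity, fun θ hθ => ?_, fun x θ hθ => ?_, fun x => ?_, fun x θ hθ => ?_, ?_⟩
  · exact measurable_pathEstFun hh (interior_subset (hsub' hθ))
  · exact HasFDerivAt.fun_sum (u := Finset.univ)
      (A := fun j : Fin m => h (x j.castSucc) (x j.succ)) fun j _ => hreg.hasFDerivAt _ _ (hsub' hθ)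
  · exact tendsto_finsetSum _ fun j _ => hreg.continuousAt_dh _ _ hθ₀
  · exact norm_sum_le_of_le _ fun j _ =>
      hb θ (Metric.ball_subset_closedBall hθ) (x j.castSucc, x j.succ)
  · exact (hY.markov 0).integrable_pathSum (Mod.invariant θ₀) hbi

/-- The estimating functions are asymptotically linear at the true parameter. -/
lemma asymptoticallyLinear_estFun (hθ₀ : (θ₀ : EuclideanSpace ℝ (Fin p)) ∈ interior Θ)
    (hm : 1 ≤ m) (hY : IsIIDSample Pr Mod θ₀ Y)
    (hh : Measurable fun z : D × D × Θ => h z.1 z.2.1 z.2.2)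
    (hmart : IsMartingaleEstFun Mod Δ h)
    (hreg : RegularityCondition Θ (pairLaw Mod θ₀ Δ) h θ₀) :
    AsymptoticallyLinear Pr (estFun h Y Δ m) θ₀
      (Matrix.toEuclideanCLM (𝕜 := ℝ) ((m : ℝ) • meanJacobian Θ (pairLaw Mod θ₀ Δ) h θ₀))
      (Matrix.toEuclideanCLM (𝕜 := ℝ) ((m : ℝ)⁻¹ • (meanJacobian Θ (pairLaw Mod θ₀ Δ) h θ₀)⁻¹))
      ((m : ℝ)⁻¹ • sandwich Θ (pairLaw Mod θ₀ Δ) h θ₀) := by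
  have := Mod.isMarkovKernel θ₀
  have hm0 : (m : ℝ) ≠ 0 := by positivity
  have hX := fun i => hY.measurePreserving_skeleton (Δ := Δ) (m := m) i
  have hind := hY.iIndepFun_skeleton (Δ := Δ) (m := m)
  have hinv := Mod.invariant θ₀
  obtain ⟨r₀, H, hdom⟩ := exists_locallyDominated (m := m) hθ₀ hY hh hreg
  have hθΘ : (θ₀ : EuclideanSpace ℝ (Fin p)) ∈ Θ := θ₀.2
  have hdet := (Matrix.isUnit_iff_isUnit_det _).1 hreg.invertible
  have hL2 := hreg.sq_integrable _ hθΘ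
  have hfm := measurable_pathEstFun (m := m) hh hθΘ
  have hfL2 : MemLp (fun x => pathEstFun h m x θ₀) 2 (Pr.map (skeleton (Y 0) Δ m)) :=
    (hY.markov 0).memLp_pathSum hinv hL2
  have hfi : Integrable (fun x => pathEstFun h m x θ₀) (Pr.map (skeleton (Y 0) Δ m)) :=
    (hY.markov 0).integrable_pathSum hinv (hL2.integrable one_le_two)
  have hf0 : ∫ x, pathEstFun h m x θ₀ ∂(Pr.map (skeleton (Y 0) Δ m)) = 0 := by
    have h1 := (hY.markov 0).integral_pathSum (m := m) (Δ := Δ) hinv (u := fun a b => h a b θ₀)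
      (hL2.integrable one_le_two)
    have h2 := hmart.integral_eq_zero (hL2.integrable one_le_two)
    rw [pairLaw] at h2
    rw [h2, smul_zero] at h1
    exact h1
  have hdhm := hreg.measurable_dh hh hθ₀
  have hdhi : Integrable (fun z : D × D => dh Θ h z.1 z.2 θ₀) (pairLaw Mod θ₀ Δ) := by
    obtain ⟨hbar, hbi, hb⟩ := hreg.dominated {(θ₀ : EuclideanSpace ℝ (Fin p))}
      (singleton_subset_iff.2 hθΘ) isCompact_singleton
    exact hbi.mono' hdhm.aestronglyMeasurable (Eventually.of_forall fun z => hb _ rfl z)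
  refine ⟨fun v => ?_, fun v => ?_, fun c hc => ?_, fun ε hε => ?_, ?_⟩
  · rw [← mul_apply_eq_comp, ← map_mul, smul_mul_smul_comm, inv_mul_cancel₀ hm0,
      Matrix.nonsing_inv_mul _ hdet, one_smul, map_one, one_apply_eq_self]
  · rw [← mul_apply_eq_comp, ← map_mul, smul_mul_smul_comm, mul_inv_cancel₀ hm0,
      Matrix.mul_nonsing_inv _ hdet, one_smul, map_one, one_apply_eq_self]
  -- Each of the `m` consecutive pairs contributes the same mean Jacobian.
  · have hA : ∫ x, pathSum (fun a b => dh Θ h a b θ₀) x ∂(Pr.map (skeleton (Y 0) Δ m)) =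
        Matrix.toEuclideanCLM (𝕜 := ℝ)
          ((m : ℝ) • meanJacobian Θ (pairLaw Mod θ₀ Δ) h θ₀) := by
      have h1 := (hY.markov 0).integral_pathSum (m := m) (Δ := Δ) hinv
        (u := fun a b => dh Θ h a b θ₀) hdhi
      have h2 := integral_dh_eq hdhi
      rw [pairLaw] at h2
      rw [h1, h2, map_smul]
      rfl
    obtain ⟨r, hr, -, hev⟩ := eventuallyAS_approximatesLinearOn hX hind hdom
      (measurable_pathSum hdhm) hc
    refine ⟨r, hr, hev.mono fun n ω hω => ?_⟩
    rw [hA] at hω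
    simpa only [← estFun_eq_average] using hω
  · refine (eventuallyAS_dist_average_lt hX hind hfm hfi hε).mono fun n ω hω => ?_
    rw [hf0, dist_zero_right] at hω
    rw [estFun_eq_average]
    exact hω
  · let B := (meanJacobian Θ (pairLaw Mod θ₀ Δ) h θ₀)⁻¹
    let A' := Matrix.toEuclideanCLM (𝕜 := ℝ) ((m : ℝ)⁻¹ • B)
    have hclt := tendstoInDistribution_multivariateGaussian hX hind
      (g := fun x => -A' (pathEstFun h m x θ₀)) (A'.measurable.comp hfm).neg
      (A'.comp_memLp' hfL2).neg ?_
      (smul_sandwich_isHermitian (Θ := Θ) (Q := pairLaw Mod θ₀ Δ) (h := h)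
        (θ₀ := (θ₀ : EuclideanSpace ℝ (Fin p))) (m : ℝ)⁻¹) ?_
    · refine hclt.congr (fun n => Eventually.of_forall fun ω => ?_) (Eventually.of_forall fun _ => rfl)
      change _ = √(n : ℝ) • -A' (estFun h Y Δ m n θ₀ ω)
      rw [estFun_eq_average]
      simp only [average, map_smul, map_sum, Finset.sum_neg_distrib, smul_neg,
        smul_smul]
      congr 2
      rcases Nat.eq_zero_or_pos n with rfl | hn
      · simp
      · have hn0 : (0 : ℝ) < n := Nat.cast_pos.2 hn
        rw [← div_eq_mul_inv, Real.sqrt_div_self', one_div]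
    · rw [integral_neg, A'.integral_comp_comm hfi, hf0, map_zero, neg_zero]
    · intro t
      let s := Matrix.toEuclideanCLM (𝕜 := ℝ) B.transpose t
      have hu : ∀ v, inner ℝ (-A' v) t = -(m : ℝ)⁻¹ * inner ℝ v s := by
        intro v
        have h1 : A' v = (m : ℝ)⁻¹ • Matrix.toEuclideanCLM (𝕜 := ℝ) B v := by
          simp only [A', map_smul]
          rfl
        rw [h1, inner_neg_left, inner_smul_left, inner_toEuclideanCLM_left]
        simp [s]
      -- The factor $m^{-2}$ meets the factor $m$ from the orthogonality of the martingale
      -- differences and leaves the $m^{-1}$ of the limit covariance.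
      have hpath : ∀ x, (inner ℝ (-A' (pathEstFun h m x θ₀)) t) ^ 2 =
          ((m : ℝ)⁻¹) ^ 2 * (pathSum (fun a b => inner ℝ (h a b θ₀) s) x) ^ 2 := by
        intro x
        rw [hu, pathEstFun, pathSum, sum_inner, pathSum]
        ring
      have hum : Measurable fun z : D × D => inner ℝ (h z.1 z.2 θ₀) s :=
        (measurable_estimating_function hh hθΘ).inner_const
      have hsum := (hY.markov 0).integral_pathSum_sq (Δ := Δ) hinv
        (u := fun a b => inner ℝ (h a b θ₀) s) hum (hL2.inner_const s) (fun x => ?_) m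
      · simp_rw [hpath]
        rw [integral_const_mul, integral_map (hX 0).measurable.aemeasurable
          ((measurable_pathSum hum).pow_const 2).aestronglyMeasurable, hsum,
          dotProduct_smul_sandwich_mulVec]
        have h3 := integral_inner_sq hL2 s
        rw [pairLaw] at h3
        rw [h3]
        simp only [s, B, pairLaw]
        field_simp
      · have h4 := integral_inner (𝕜 := ℝ) (hmart θ₀ x).1 s
        simp only [real_inner_comm s]
        rw [h4, (hmart θ₀ x).2, inner_zero_right]

end Sample

/-! ### Existence of consistent estimators and exclusion of distant roots -/

section Existence

/-- The $\sigma$-field on `Ω` is left arbitrary because the selection theorem needs joint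
measurability for the uncompleted data $\sigma$-field. -/
lemma measurable_estFun_prod {Ω D : Type*} [MeasurableSpace Ω] [MeasurableSpace D] {p : ℕ}
    {Θ : Set (EuclideanSpace ℝ (Fin p))}
    {h : D → D → EuclideanSpace ℝ (Fin p) → EuclideanSpace ℝ (Fin p)}
    (hh : Measurable fun z : D × D × Θ => h z.1 z.2.1 z.2.2) {Y : ℕ → ℝ≥0 → Ω → D} {Δ : ℝ≥0}
    {m n : ℕ} (hY : ∀ i < n, ∀ j ≤ m, Measurable (Y i ((j : ℕ) * Δ))) :
    Measurable fun q : Ω × Θ => (n : ℝ)⁻¹ • ∑ i ∈ Finset.range n, ∑ j ∈ Finset.range m,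
      h (Y i ((j : ℝ≥0) * Δ) q.1) (Y i (((j + 1 : ℕ) : ℝ≥0) * Δ) q.1) q.2 := by
  refine Measurable.fun_const_smul (Finset.measurable_sum _ fun i hi =>
    Finset.measurable_sum _ fun j hj => ?_) _
  have hi' := Finset.mem_range.1 hi
  have hj' := Finset.mem_range.1 hj
  exact hh.comp (((hY i hi' j hj'.le).comp measurable_fst).prodMk
    (((hY i hi' (j + 1) hj').comp measurable_fst).prodMk measurable_snd))

variable {Ω D : Type*} [mΩ : MeasurableSpace Ω] [MeasurableSpace D] {Pr : Measure Ω}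
  [IsProbabilityMeasure Pr] {p : ℕ} {Θ : Set (EuclideanSpace ℝ (Fin p))}
  {Mod : StationaryMarkovModel D Θ} {θ₀ : Θ} {Δ : ℝ≥0} {m : ℕ} {Y : ℕ → ℝ≥0 → Ω → D}
  {h : D → D → EuclideanSpace ℝ (Fin p) → EuclideanSpace ℝ (Fin p)}

lemma IsIIDSample.iSup_comap_le (hY : IsIIDSample Pr Mod θ₀ Y) (n : ℕ) :
    (⨆ (i : Fin n) (j : Fin (m + 1)),
      MeasurableSpace.comap (Y i ((j : ℕ) * Δ)) inferInstance) ≤ mΩ :=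
  iSup_le fun i => iSup_le fun _ => ((hY.markov i).measurable _).comap_le

/-- There are estimators which select a root in a given ball whenever there is one. -/
lemma exists_isGEstimator (hΘ : MeasurableSet Θ) (hY : IsIIDSample Pr Mod θ₀ Y)
    (hh : Measurable fun z : D × D × Θ => h z.1 z.2.1 z.2.2) (n : ℕ) (r : ℝ) :
    ∃ T : Ω → Option Θ, IsGEstimator (obsSigma Pr Y Δ m n) (estFun h Y Δ m n) T ∧
      ∀ ω, (∃ θ : Θ, estFun h Y Δ m n θ ω = 0 ∧ dist θ θ₀ < r) →
        ∃ θ : Θ, T ω = some θ ∧ dist θ θ₀ < r := by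
  have hle := hY.iSup_comap_le (Δ := Δ) (m := m) n
  have hsel := fun S hS => exists_isMeasurableEst_selector Pr hΘ hle (S := S) hS
  let 𝒢 : MeasurableSpace Ω := ⨆ (i : Fin n) (j : Fin (m + 1)),
    MeasurableSpace.comap (Y i ((j : ℕ) * Δ)) inferInstance
  have hY𝒢 : ∀ i < n, ∀ j ≤ m, Measurable[𝒢] (Y i ((j : ℕ) * Δ)) := by
    intro i hi j hj
    refine (comap_measurable (Y i ((j : ℕ) * Δ))).mono ?_ le_rfl
    exact le_iSup₂_of_le (f := fun (i : Fin n) (j : Fin (m + 1)) =>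
      MeasurableSpace.comap (Y i ((j : ℕ) * Δ)) inferInstance) ⟨i, hi⟩
      ⟨j, Nat.lt_succ_of_le hj⟩ le_rfl
  have hG : Measurable[𝒢.prod inferInstance]
      fun q : Ω × Θ => estFun h Y Δ m n q.2 q.1 :=
    @measurable_estFun_prod Ω D 𝒢 _ p Θ h hh Y Δ m n hY𝒢
  let S : Set (Ω × Θ) := {q | estFun h Y Δ m n q.2 q.1 = 0}
  have hS : MeasurableSet[𝒢.prod inferInstance] S := hG (measurableSet_singleton 0)
  let B : Set (Ω × Θ) := {q | dist q.2 θ₀ < r}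
  have hB : MeasurableSet[𝒢.prod inferInstance] B :=
    (@measurable_snd Ω Θ 𝒢 _) (Metric.isOpen_ball (x := θ₀) (ε := r)).measurableSet
  -- `T₀` selects any root and `T₁` a root in the ball. Preferring `T₁` and falling back on `T₀`
  -- gives an estimator on the whole of $D_n$.
  obtain ⟨T₀, hT₀, hT₀S, hT₀n⟩ := hsel S hS
  obtain ⟨T₁, hT₁, hT₁S, hT₁n⟩ := hsel (S ∩ B) (hS.inter hB)
  let T : Ω → Option Θ := fun ω => (T₁ ω).or (T₀ ω)
  have hT1 : ∀ ω, T₁ ω ≠ none → T ω = T₁ ω := by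
    intro ω hω
    cases h1 : T₁ ω with
    | none => exact absurd h1 hω
    | some θ => simp [T, h1]
  have hT0 : ∀ ω, T₁ ω = none → T ω = T₀ ω := fun ω hω => by simp [T, hω]
  have hTS : ∀ ω θ, T ω = some θ → (ω, θ) ∈ S := by
    intro ω θ hω
    by_cases h1 : T₁ ω = none
    · exact hT₀S ω θ (hT0 ω h1 ▸ hω)
    · exact (hT₁S ω θ (hT1 ω h1 ▸ hω)).1
  refine ⟨T, ⟨fun C hC => ?_, ?_, ?_⟩, ?_⟩
  · have : {ω | ∃ θ ∈ C, T ω = some θ} = {ω | ∃ θ ∈ C, T₁ ω = some θ} ∪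
        ({ω | T₁ ω = none} ∩ {ω | ∃ θ ∈ C, T₀ ω = some θ}) := by
      ext ω
      by_cases h1 : T₁ ω = none
      · simp only [mem_ofPred_eq, mem_union, mem_inter_iff, hT0 ω h1, h1, reduceCtorEq, and_false,
          exists_false, true_and, false_or]
      · simp only [mem_ofPred_eq, mem_union, mem_inter_iff, hT1 ω h1, h1, false_and, or_false]
    rw [this]
    exact (hT₁ C hC).union (hT₁.measurableSet_eq_none.inter (hT₀ C hC))
  · rintro ω ⟨θ, hθ, hθ0⟩
    have hne : T ω ≠ none := by
      by_cases h1 : T₁ ω = none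
      · rw [hT0 ω h1]
        exact hT₀n ω ⟨⟨θ, hθ⟩, hθ0⟩
      · rwa [hT1 ω h1]
    obtain ⟨θ', hθ'⟩ := Option.ne_none_iff_exists'.1 hne
    exact ⟨θ', hθ', hTS ω θ' hθ'⟩
  · intro ω hω
    by_contra hne
    obtain ⟨θ', hθ'⟩ := Option.ne_none_iff_exists'.1 hne
    exact hω ⟨θ', θ'.2, hTS ω θ' hθ'⟩
  · rintro ω ⟨θ, hθ0, hθr⟩
    have h1 : T₁ ω ≠ none := hT₁n ω ⟨θ, hθ0, hθr⟩
    obtain ⟨θ', hθ'⟩ := Option.ne_none_iff_exists'.1 h1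
    exact ⟨θ', (hT1 ω h1).trans hθ', (hT₁S ω θ' hθ').2⟩

lemma AsymptoticallyLinear.exists_eventuallyAS_root_unique
    {G : ℕ → EuclideanSpace ℝ (Fin p) → Ω → EuclideanSpace ℝ (Fin p)}
    {A A' : EuclideanSpace ℝ (Fin p) →L[ℝ] EuclideanSpace ℝ (Fin p)}
    {S : Matrix (Fin p) (Fin p) ℝ} (hG : AsymptoticallyLinear Pr G θ₀ A A' S) :
    ∃ r : ℝ, 0 < r ∧ EventuallyAS Pr fun n ω => ∀ θ θ' : Θ, dist θ θ₀ < r → dist θ' θ₀ < r →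
      G n θ ω = 0 → G n θ' ω = 0 → θ = θ' := by
  obtain ⟨K, hK0, hK⟩ := exists_pos_norm_le A'
  let c : ℝ≥0 := ⟨1 / (2 * K), by positivity⟩
  have hc : 0 < c := by change (0 : ℝ) < 1 / (2 * K); positivity
  obtain ⟨r, hr, hap⟩ := hG.approx c hc
  exact ⟨r, hr, hap.mono fun n ω hω θ θ' h1 h2 h3 h4 => Subtype.ext
    (ApproximatesLinearOn.root_unique hω hG.leftInverse hK hK0 le_rfl h1 h2 h3 h4)⟩

/-- Existence of consistent sequences of estimators. -/
lemma exists_consistent_isGEstimator (hΘ : MeasurableSet Θ) (hY : IsIIDSample Pr Mod θ₀ Y)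
    (hh : Measurable fun z : D × D × Θ => h z.1 z.2.1 z.2.2)
    {A A' : EuclideanSpace ℝ (Fin p) →L[ℝ] EuclideanSpace ℝ (Fin p)}
    {S : Matrix (Fin p) (Fin p) ℝ} (hG : AsymptoticallyLinear Pr (estFun h Y Δ m) θ₀ A A' S)
    (hθ₀ : (θ₀ : EuclideanSpace ℝ (Fin p)) ∈ interior Θ) :
    ∃ T : ℕ → Ω → Option Θ,
      (∀ n, IsGEstimator (obsSigma Pr Y Δ m n) (estFun h Y Δ m n) (T n)) ∧
      ∀ ε : ℝ, 0 < ε → EventuallyAS Pr fun n ω => distTo θ₀ (T n ω) < ε := by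
  -- The radius of uniqueness does not depend on `ε`: the root selected in this ball must be the one
  -- eventually found arbitrarily close to `θ₀`, so a single sequence serves every `ε`.
  obtain ⟨r, hr, huniq⟩ := hG.exists_eventuallyAS_root_unique
  choose T hT hTr using fun n => exists_isGEstimator (Δ := Δ) (m := m) hΘ hY hh n r
  refine ⟨T, hT, fun ε hε => ?_⟩
  have hε' : 0 < min (ε / 2) (r / 2) := by positivity
  refine (huniq.and (hG.eventuallyAS_root hθ₀ hε')).mono fun n ω ⟨h1, θ, hθ, hθ0⟩ => ?_
  have hθr : dist θ θ₀ < r := hθ.trans_lt ((min_le_right _ _).trans_lt (by linarith))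
  obtain ⟨θ', hθ', hθr'⟩ := hTr n ω ⟨θ, hθ0, hθr⟩
  have heq := h1 θ' θ hθr' hθr ((hT n).eq_zero hθ') hθ0
  rw [hθ', heq]
  exact hθ.trans_lt ((min_le_left _ _).trans_lt (by linarith))

lemma stronglyConsistent_of_eventuallyAS {T : ℕ → Ω → Option Θ}
    (hT : ∀ ε : ℝ, 0 < ε → EventuallyAS Pr fun n ω => distTo θ₀ (T n ω) < ε) :
    StronglyConsistent Pr θ₀ T := by
  have h1 : ∀ᵐ ω ∂Pr, ∀ k : ℕ, ∀ᶠ n in atTop, distTo θ₀ (T n ω) < 1 / ((k : ℝ) + 1) :=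
    ae_all_iff.2 fun k => (hT _ (by positivity)).ae
  filter_upwards [h1] with ω hω
  rw [Metric.tendsto_atTop']
  intro ε hε
  obtain ⟨k, hk⟩ := exists_nat_one_div_lt hε
  obtain ⟨N, hN⟩ := eventually_atTop.1 (hω k)
  refine ⟨N, fun n hn => ?_⟩
  rw [Real.dist_eq, sub_zero, abs_of_nonneg (distTo_nonneg _ _)]
  exact (hN n hn.le).trans hk

lemma exists_envelope_pathEstFun (hY : IsIIDSample Pr Mod θ₀ Y)
    (hreg : RegularityCondition Θ (pairLaw Mod θ₀ Δ) h θ₀) (hacc : RectifiablyAccessible Θ)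
    {K : Set (EuclideanSpace ℝ (Fin p))} (hKΘ : K ⊆ Θ) (hK : IsCompact K) :
    ∃ H : (Fin (m + 1) → D) → ℝ, Integrable H (Pr.map (skeleton (Y 0) Δ m)) ∧
      ∀ x, ∀ θ ∈ K, ‖pathEstFun h m x θ‖ ≤ H x := by
  have := Mod.isMarkovKernel θ₀
  obtain ⟨H, hHi, hH⟩ := hreg.exists_envelope hacc hKΘ hK
  refine ⟨fun x => pathSum (fun a b => H (a, b)) x,
    (hY.markov 0).integrable_pathSum (Mod.invariant θ₀) hHi, fun x θ hθ => ?_⟩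
  exact norm_sum_le_of_le _ fun (j : Fin m) _ => hH θ hθ (x j.castSucc, x j.succ)

/-- Away from the true parameter there are no roots in a compact set. -/
lemma eventuallyAS_no_root (hm : 1 ≤ m) (hY : IsIIDSample Pr Mod θ₀ Y)
    (hh : Measurable fun z : D × D × Θ => h z.1 z.2.1 z.2.2)
    (hreg : RegularityCondition Θ (pairLaw Mod θ₀ Δ) h θ₀) (hacc : RectifiablyAccessible Θ)
    (hid : ∀ θ : Θ, θ ≠ θ₀ → ∫ z, h z.1 z.2 θ ∂(pairLaw Mod θ₀ Δ) ≠ 0)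
    {K : Set (EuclideanSpace ℝ (Fin p))} (hKΘ : K ⊆ Θ) (hK : IsCompact K) {ε : ℝ} (hε : 0 < ε) :
    EventuallyAS Pr fun n ω => ∀ θ : Θ, (θ : EuclideanSpace ℝ (Fin p)) ∈ K → ε < dist θ θ₀ →
      estFun h Y Δ m n θ ω ≠ 0 := by
  have := Mod.isMarkovKernel θ₀
  have hm0 : (m : ℝ) ≠ 0 := by positivity
  -- Removing an open ball keeps the set compact and discards `θ₀`, the only possible zero of the
  -- mean.
  let K' : Set (EuclideanSpace ℝ (Fin p)) :=
    K \ Metric.ball (θ₀ : EuclideanSpace ℝ (Fin p)) ε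
  have hK' : IsCompact K' := hK.diff Metric.isOpen_ball
  have hKK : K' ⊆ Θ := sdiff_subset.trans hKΘ
  obtain ⟨H, hHi, hH⟩ := exists_envelope_pathEstFun (m := m) hY hreg hacc hKK hK'
  have hmain := eventuallyAS_average_ne_zero
    (fun i => hY.measurePreserving_skeleton (Δ := Δ) (m := m) i)
    (hY.iIndepFun_skeleton (Δ := Δ) (m := m)) hK'
    (fun θ hθ => measurable_pathEstFun hh (hKK hθ)) (fun x => ?_) hHi hH (fun θ hθ => ?_)
  · refine hmain.mono fun n ω hω θ hθK hθε => ?_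
    rw [estFun_eq_average]
    exact hω θ ⟨hθK, fun hb => lt_asymm hθε (Metric.mem_ball.1 hb)⟩
  · exact continuousOn_finsetSum (f := fun (j : Fin m) θ => h (x j.castSucc) (x j.succ) θ) Finset.univ
      fun j _ => (hreg.contDiff _ _).continuousOn.mono hKK
  · have h1 := (hY.markov 0).integral_pathSum (m := m) (Δ := Δ) (Mod.invariant θ₀)
      (u := fun a b => h a b θ) ((hreg.sq_integrable θ (hKK hθ)).integrable one_le_two)
    change ∫ x, pathSum (fun a b => h a b θ) x ∂_ ≠ 0
    rw [h1]
    refine smul_ne_zero hm0 (hid ⟨θ, hKK hθ⟩ fun heq => hθ.2 ?_)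
    rw [← heq]
    exact Metric.mem_ball_self hε

end Existence

/-! ### Consistency from confinement to a compact set -/

section Consistency

variable {Ω D : Type*} [mΩ : MeasurableSpace Ω] [MeasurableSpace D] {Pr : Measure Ω}
  [IsProbabilityMeasure Pr] {p : ℕ} {Θ : Set (EuclideanSpace ℝ (Fin p))}
  {Mod : StationaryMarkovModel D Θ} {θ₀ : Θ} {Δ : ℝ≥0} {m : ℕ} {Y : ℕ → ℝ≥0 → Ω → D}
  {h : D → D → EuclideanSpace ℝ (Fin p) → EuclideanSpace ℝ (Fin p)}

lemma tendsto_measure_mem_compact (hm : 1 ≤ m) (hY : IsIIDSample Pr Mod θ₀ Y)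
    (hh : Measurable fun z : D × D × Θ => h z.1 z.2.1 z.2.2)
    (hreg : RegularityCondition Θ (pairLaw Mod θ₀ Δ) h θ₀) (hacc : RectifiablyAccessible Θ)
    (hid : ∀ θ : Θ, θ ≠ θ₀ → ∫ z, h z.1 z.2 θ ∂(pairLaw Mod θ₀ Δ) ≠ 0)
    {ℱ : ℕ → MeasurableSpace Ω} {T : ℕ → Ω → Option Θ}
    (hT : ∀ n, IsGEstimator (ℱ n) (estFun h Y Δ m n) (T n))
    {K : Set (EuclideanSpace ℝ (Fin p))} (hKΘ : K ⊆ Θ) (hK : IsCompact K) {ε : ℝ} (hε : 0 < ε) :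
    Tendsto (fun n => Pr {ω | ∃ θ : Θ, T n ω = some θ ∧
      (θ : EuclideanSpace ℝ (Fin p)) ∈ K ∧ ε < dist θ θ₀}) atTop (𝓝 0) := by
  refine tendsto_of_tendsto_of_tendsto_of_le_of_le tendsto_const_nhds
    (eventuallyAS_no_root hm hY hh hreg hacc hid hKΘ hK hε).tendsto_measure
    (fun n => zero_le) fun n => measure_mono ?_
  rintro ω ⟨θ, hθ, hθK, hθε⟩ hno
  exact hno θ hθK hθε ((hT n).eq_zero hθ)

lemma AsymptoticallyLinear.weaklyConsistent_of_isCompact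
    {A A' : EuclideanSpace ℝ (Fin p) →L[ℝ] EuclideanSpace ℝ (Fin p)}
    {S : Matrix (Fin p) (Fin p) ℝ} (hG : AsymptoticallyLinear Pr (estFun h Y Δ m) θ₀ A A' S)
    (hθ₀ : (θ₀ : EuclideanSpace ℝ (Fin p)) ∈ interior Θ)
    (hm : 1 ≤ m) (hY : IsIIDSample Pr Mod θ₀ Y)
    (hh : Measurable fun z : D × D × Θ => h z.1 z.2.1 z.2.2)
    (hreg : RegularityCondition Θ (pairLaw Mod θ₀ Δ) h θ₀) (hacc : RectifiablyAccessible Θ)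
    (hid : ∀ θ : Θ, θ ≠ θ₀ → ∫ z, h z.1 z.2 θ ∂(pairLaw Mod θ₀ Δ) ≠ 0)
    {ℱ : ℕ → MeasurableSpace Ω} {T : ℕ → Ω → Option Θ}
    (hT : ∀ n, IsGEstimator (ℱ n) (estFun h Y Δ m n) (T n)) (hΘ : IsCompact Θ) :
    WeaklyConsistent Pr θ₀ T := by
  refine weaklyConsistent_of_mem (K := Θ) ?_ fun ε hε =>
    tendsto_measure_mem_compact hm hY hh hreg hacc hid hT Subset.rfl hΘ hε
  refine ((hG.eventuallyAS_root hθ₀ one_pos).mono (q' := fun n ω => ∃ θ : Θ, T n ω = some θ ∧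
    (θ : EuclideanSpace ℝ (Fin p)) ∈ Θ) fun n ω ⟨θ, _, hθ⟩ => ?_).tendsto_measure
  obtain ⟨θ', hθ'⟩ := (hT n).exists_eq_some hθ
  exact ⟨θ', hθ', θ'.2⟩

/-- There is eventually a root near `θ₀`, and the centred estimator is no farther from `ρ` in the
`ψ`-metric than that root. It therefore stays in a fixed compact set, where distant roots are
excluded. -/
lemma AsymptoticallyLinear.weaklyConsistent_of_isCenteredGEstimator
    {A A' : EuclideanSpace ℝ (Fin p) →L[ℝ] EuclideanSpace ℝ (Fin p)}
    {S : Matrix (Fin p) (Fin p) ℝ} (hG : AsymptoticallyLinear Pr (estFun h Y Δ m) θ₀ A A' S)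
    (hθ₀ : (θ₀ : EuclideanSpace ℝ (Fin p)) ∈ interior Θ)
    (hm : 1 ≤ m) (hY : IsIIDSample Pr Mod θ₀ Y)
    (hh : Measurable fun z : D × D × Θ => h z.1 z.2.1 z.2.2)
    (hreg : RegularityCondition Θ (pairLaw Mod θ₀ Δ) h θ₀) (hacc : RectifiablyAccessible Θ)
    (hid : ∀ θ : Θ, θ ≠ θ₀ → ∫ z, h z.1 z.2 θ ∂(pairLaw Mod θ₀ Δ) ≠ 0)
    {ψ : Θ ≃ₜ EuclideanSpace ℝ (Fin p)} {ρ : Θ}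
    {ℱ : ℕ → MeasurableSpace Ω} {T : ℕ → Ω → Option Θ}
    (hT : ∀ n, IsCenteredGEstimator (ℱ n) (estFun h Y Δ m n) ψ ρ (T n)) :
    WeaklyConsistent Pr θ₀ T := by
  -- The slack 1 allows for the `ψ`-distance between `θ₀` and the nearby root.
  let R := dist (ψ θ₀) (ψ ρ) + 1
  let K : Set (EuclideanSpace ℝ (Fin p)) :=
    (fun z => (ψ.symm z : EuclideanSpace ℝ (Fin p))) '' Metric.closedBall (ψ ρ) R
  have hK : IsCompact K :=
    (isCompact_closedBall _ _).image (continuous_subtype_val.comp ψ.symm.continuous)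
  have hKΘ : K ⊆ Θ := by
    rintro _ ⟨z, -, rfl⟩
    exact (ψ.symm z).2
  refine weaklyConsistent_of_mem (K := K) ?_ fun ε hε =>
    tendsto_measure_mem_compact hm hY hh hreg hacc hid (fun n => (hT n).isGEstimator) hKΘ hK hε
  obtain ⟨ε, hε, hψ⟩ := Metric.continuousAt_iff.1 ψ.continuous.continuousAt 1 one_pos
  refine ((hG.eventuallyAS_root hθ₀ (half_pos hε)).mono (q' := fun n ω => ∃ θ : Θ, T n ω = some θ ∧
    (θ : EuclideanSpace ℝ (Fin p)) ∈ K) fun n ω ⟨θ, hθε, hθ⟩ => ?_).tendsto_measure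
  obtain ⟨θ', hθ', -, hmin⟩ := (hT n).argmin ω ⟨θ, θ.2, hθ⟩
  refine ⟨θ', hθ', ψ θ', Metric.mem_closedBall.2 ?_, by simp⟩
  have h1 := hψ (hθε.trans_lt (half_lt_self hε))
  have h2 := hmin θ hθ
  have h3 := dist_triangle (ψ θ) (ψ θ₀) (ψ ρ)
  change _ ≤ dist (ψ θ₀) (ψ ρ) + 1
  linarith

end Consistency

end Longitudinal

end

/-! ### The main theorem -/

theorem mainTheorem7 {Ω D : Type*} [MeasurableSpace Ω] [MeasurableSpace D]
    (Pr : Measure Ω) [IsProbabilityMeasure Pr] {p : ℕ}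
    (Θ : Set (EuclideanSpace ℝ (Fin p))) (hΘ : MeasurableSet Θ)
    (Mod : Longitudinal.StationaryMarkovModel D Θ)
    (θ₀ : Θ) (hθ₀ : (θ₀ : EuclideanSpace ℝ (Fin p)) ∈ interior Θ)
    (Δ : ℝ≥0) (hΔ : 0 < Δ) (m : ℕ) (hm : 1 ≤ m)
    (Y : ℕ → ℝ≥0 → Ω → D) (hY : Longitudinal.IsIIDSample Pr Mod θ₀ Y)
    (h : D → D → EuclideanSpace ℝ (Fin p) → EuclideanSpace ℝ (Fin p))
    (hh : Measurable fun z : D × D × Θ => h z.1 z.2.1 z.2.2)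
    (hmart : Longitudinal.IsMartingaleEstFun Mod Δ h)
    (hreg : Longitudinal.RegularityCondition Θ (Longitudinal.pairLaw Mod θ₀ Δ) h θ₀) :
    (∃ T : ℕ → Ω → Option Θ,
      (∀ n, Longitudinal.IsGEstimator (Longitudinal.obsSigma Pr Y Δ m n)
        (Longitudinal.estFun h Y Δ m n) (T n)) ∧
      Longitudinal.StronglyConsistent Pr θ₀ T ∧
      Longitudinal.EventuallyUnique Pr (Longitudinal.obsSigma Pr Y Δ m)
        (Longitudinal.estFun h Y Δ m) θ₀ T ∧
      Longitudinal.AsymptoticallyNormal Pr θ₀ T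
        ((m : ℝ)⁻¹ • Longitudinal.sandwich Θ (Longitudinal.pairLaw Mod θ₀ Δ) h θ₀)) ∧
    (Longitudinal.RectifiablyAccessible Θ →
      (∀ θ : Θ, θ ≠ θ₀ → ∫ z, h z.1 z.2 θ ∂(Longitudinal.pairLaw Mod θ₀ Δ) ≠ 0) →
      (∀ T : ℕ → Ω → Option Θ,
        (∀ n, Longitudinal.IsGEstimator (Longitudinal.obsSigma Pr Y Δ m n)
          (Longitudinal.estFun h Y Δ m n) (T n)) →
        ∀ K ⊆ Θ, IsCompact K → K ∈ 𝓝 (θ₀ : EuclideanSpace ℝ (Fin p)) → ∀ ε : ℝ, 0 < ε →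
          Tendsto (fun n => Pr {ω | ∃ θ : Θ, T n ω = some θ ∧
            (θ : EuclideanSpace ℝ (Fin p)) ∈ K ∧ ε < dist θ θ₀}) atTop (𝓝 0)) ∧
      (IsCompact Θ → ∀ T : ℕ → Ω → Option Θ,
        (∀ n, Longitudinal.IsGEstimator (Longitudinal.obsSigma Pr Y Δ m n)
          (Longitudinal.estFun h Y Δ m n) (T n)) →
        Longitudinal.AsymptoticallyNormal Pr θ₀ T
          ((m : ℝ)⁻¹ • Longitudinal.sandwich Θ (Longitudinal.pairLaw Mod θ₀ Δ) h θ₀)) ∧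
      (∀ (ψ : Θ ≃ₜ EuclideanSpace ℝ (Fin p)) (ρ : Θ) (T : ℕ → Ω → Option Θ),
        (∀ n, Longitudinal.IsCenteredGEstimator (Longitudinal.obsSigma Pr Y Δ m n)
          (Longitudinal.estFun h Y Δ m n) ψ ρ (T n)) →
        Longitudinal.AsymptoticallyNormal Pr θ₀ T
          ((m : ℝ)⁻¹ • Longitudinal.sandwich Θ (Longitudinal.pairLaw Mod θ₀ Δ) h θ₀))) := by
  have hG := Longitudinal.asymptoticallyLinear_estFun hθ₀ hm hY hh hmart hreg
  have hle := fun n => hY.iSup_comap_le (Δ := Δ) (m := m) n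
  refine ⟨?_, fun hacc hid => ⟨fun T hT K hKΘ hK _ ε hε => ?_, fun hΘc T hT => ?_,
    fun ψ ρ T hT => ?_⟩⟩
  · obtain ⟨T, hT, hTc⟩ := Longitudinal.exists_consistent_isGEstimator hΘ hY hh hG hθ₀
    have hw : Longitudinal.WeaklyConsistent Pr θ₀ T :=
      Longitudinal.weaklyConsistent_iff.2 fun ε hε => (hTc ε hε).tendsto_measure
    exact ⟨T, hT, Longitudinal.stronglyConsistent_of_eventuallyAS hTc,
      hG.eventuallyUnique hT hw, hG.asymptoticallyNormal hle hT hw⟩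
  · exact Longitudinal.tendsto_measure_mem_compact hm hY hh hreg hacc hid hT hKΘ hK hε
  · exact hG.asymptoticallyNormal hle hT
      (hG.weaklyConsistent_of_isCompact hθ₀ hm hY hh hreg hacc hid hT hΘc)
  · exact hG.asymptoticallyNormal hle (fun n => (hT n).isGEstimator)
      (hG.weaklyConsistent_of_isCenteredGEstimator hθ₀ hm hY hh hreg hacc hid hT)
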